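/- \textbf{Setting.} Let $V$ be a finite dimensional real Euclidean space with scalar product $(\cdot,\cdot)$, and let $V_s\subseteq V$ be a subspace containing a finite, reduced, irreducible crystallographic root system $R$ that spans $V_s$, with coroots $\alpha^\vee=2\alpha/(\alpha,\alpha)$. Fix simple roots $F$ of $R$, and let $\theta$ be the highest root. Let $Y\subset V$ be a lattice (discrete subgroup, not necessarily of full rank) with $\alpha^\vee\in Y$ and $(Y,\alpha)\subseteq\mathbb Z$ for all $\alpha\in R$. Put $\widehat V=V\oplus\mathbb Rc\oplus\mathbb Rd$ and extend the form by $(c,d)=1$, $(c,c)=(d,d)=(c,v)=(d,v)=0$ ($v\in V$). Let $\widehat V^+=V\oplus\mathbb Rc\oplus\mathbb R_{>0}d$ and let $\widehat{\mathfrak h}=\mathbb C\otimes_{\mathbb R}\widehat V$. For $a\in\widehat V$ with $(a,a)\neq0$ let $a^\vee=2a/(a,a)$ and $s_a(x)=x-(x,a^\vee)a$; for $u\in V$ let $t_u(v+\eta c+\xi d)=v+\xi u+\bigl(\eta-\tfrac{\xi}{2}(u,u)-(v,u)\bigr)c+\xi d$. Let $\widehat R=R+\mathbb Zc$, $a_0=-\theta+c$,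 $\widehat F=\{a_0\}\cup F$. Let $\widehat W$ be the group generated by the $s_a$ ($a\in\widehat R$), and $\widehat W^Y=W\ltimes Y\supseteq\widehat W$ the group generated by the $s_\alpha$ ($\alpha\in R$) and the $t_y$ ($y\in Y$). Let $k:\widehat R\to\mathbb C$, $a\mapsto k_a$, be $\widehat W^Y$-invariant, and let $M$ be a finite dimensional complex $\widehat W^Y$-module with representation map $\pi_M$. Let $\mathcal C$ be the set of connected components (chambers) of $\{x\in\widehat V^+ : (a,x)\neq0\ \forall a\in\widehat R\}$. The fundamental chamber is $\widehat C^+=\{x\in\widehat V : (a,x)>0\ \forall a\in\widehat F\}$; the group $\widehat W$ acts simply transitively on $\mathcal C$. Let $C^\omega(\widehat V^+)\otimes M$ be the space of real analytic $M$-valued functions on $\widehat V^+$ and $\mathcal F_M=\prod_{C\in\mathcal C}\bigl(C^\omega(\widehat V^+)\otimes M\bigr)$. For $p$ in the symmetric algebra $S(\widehat{\mathfrak h})$ let $p(\partial)$ be the constant coefficient differential operator determined by $u\mapsto\partial_u$. Let $\widehat Q$ be the unique representation of $\widehat W$ on $C^\omega(\widehat V^+)\otimes M$ with \[ (\widehat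 Q(s_a)f)(x)=\pi_M(s_a)f(s_ax)-k_a\int_0^{(a,x)}f(x-ta^\vee)\,dt\qquad(a\in\widehat F), \] and define $T:C^\omega(\widehat V^+)\otimes M\to\mathcal F_M$ by \[ (Tf)_{w\widehat C^+}(x)=\pi_M(w)\bigl((\widehat Q(w^{-1})f)(w^{-1}x)\bigr)\qquad(w\in\widehat W,\ x\in\widehat V^+). \] \textbf{Proposition.} Let $w\in\widehat W^Y$, $b\in w\widehat F$, let $x\in\widehat V^+$ with $(x,b)=0$, and let $f=(f_C)_{C\in\mathcal C}$ lie in the image of $T$. Then for all $p\in S(\widehat{\mathfrak h})$ \[ \bigl(p(\partial)f_{w\widehat C^+}\bigr)(x)-\bigl(p(\partial)f_{s_bw\widehat C^+}\bigr)(x) =k_b\,\pi_M(s_b)\Bigl(\bigl(\Delta_b(p)(\partial)f_{w\widehat C^+}\bigr)(x)\Bigr), \] where $\Delta_b(p)=\dfrac{s_bp-p}{b^\vee}\in S(\widehat{\mathfrak h})$. In particular $f_{w\widehat C^+}(x)=f_{s_bw\widehat C^+}(x)$, and for every $u\in\widehat V$ \[ (\partial_uf_{w\widehat C^+})(x)-(\partial_uf_{s_bw\widehat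 C^+})(x)=-k_b\,(u,b)\,\pi_M(s_b)f_{w\widehat C^+}(x). \] -/

import Mathlib

open scoped InnerProductSpace TensorProduct Topology

noncomputable section

/-! ### The extended space `V ⊕ ℝc ⊕ ℝd` -/

/-- The real space `V̂ = V ⊕ ℝc ⊕ ℝd`; the triple `(v, η, ξ)` stands for `v + ηc + ξd`. -/
abbrev VHat (V : Type*) : Type _ := V × ℝ × ℝ

section Space

variable {V : Type*} [NormedAddCommGroup V] [InnerProductSpace ℝ V]

/-- The symmetric bilinear form on `V̂` that extends the scalar product of `V`, with `(c, d) = 1` and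
`(c, c) = (d, d) = (c, v) = (d, v) = 0` for `v ∈ V`. -/
def hatForm : VHat V →ₗ[ℝ] VHat V →ₗ[ℝ] ℝ :=
  LinearMap.mk₂ ℝ (fun x y => ⟪x.1, y.1⟫_ℝ + x.2.1 * y.2.2 + x.2.2 * y.2.1)
    (fun x x' y => by simp [inner_add_left]; ring)
    (fun r x y => by simp [inner_smul_left]; ring)
    (fun x y y' => by simp [inner_add_right]; ring)
    (fun r x y => by simp [inner_smul_right]; ring)

theorem hatForm_apply (x y : VHat V) :
    hatForm x y = ⟪x.1, y.1⟫_ℝ + x.2.1 * y.2.2 + x.2.2 * y.2.1 := rfl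

theorem hatForm_comm (x y : VHat V) : hatForm x y = hatForm y x := by
  simp only [hatForm_apply, real_inner_comm]; ring

/-- `a^∨ = 2a/(a, a)` (used for `(a, a) ≠ 0`). -/
def hatCheck (a : VHat V) : VHat V := (2 / hatForm a a) • a

/-- The orthogonal reflection `s_a(x) = x - (x, a^∨) a` (used for `(a, a) ≠ 0`). -/
def hatReflection (a : VHat V) : VHat V ≃ₗ[ℝ] VHat V :=
  LinearEquiv.ofInvolutive
    { toFun := fun x => x - hatForm x (hatCheck a) • a
      map_add' := fun x y => by simp only [map_add, LinearMap.add_apply]; module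
      map_smul' := fun r x => by
        simp only [map_smul, LinearMap.smul_apply, RingHom.id_apply, smul_eq_mul]; module }
    (fun x => by
      by_cases h : hatForm a a = 0
      · simp [hatCheck, h]
      · have h2 : hatForm a (hatCheck a) = 2 := by
          simp only [hatCheck, map_smul, smul_eq_mul]; field_simp
        simp only [LinearMap.coe_mk, AddHom.coe_mk, map_sub, map_smul, h2]
        module)

theorem hatReflection_apply (a x : VHat V) :
    hatReflection a x = x - hatForm x (hatCheck a) • a := rfl

theorem hatReflection_form (a x y : VHat V) :
    hatForm (hatReflection a x) (hatReflection a y) = hatForm x y := by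
  by_cases h : hatForm a a = 0
  · simp [hatReflection_apply, hatCheck, h]
  · simp only [hatReflection_apply, hatCheck, map_sub, map_smul, LinearMap.sub_apply,
      LinearMap.smul_apply, smul_eq_mul, hatForm_comm a y]
    field_simp
    ring

/-- The transformation
`t_u(v + ηc + ξd) = v + ξu + (η - (ξ/2)(u, u) - (v, u)) c + ξd` attached to `u ∈ V`. -/
def hatTranslation (u : V) : VHat V ≃ₗ[ℝ] VHat V where
  toFun x := (x.1 + x.2.2 • u, x.2.1 - x.2.2 / 2 * ⟪u, u⟫_ℝ - ⟪x.1, u⟫_ℝ, x.2.2)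
  map_add' x y := by
    refine Prod.ext ?_ (Prod.ext ?_ ?_)
    · simp only [Prod.fst_add, Prod.snd_add]; module
    · simp only [Prod.fst_add, Prod.snd_add, inner_add_left]; ring
    · simp
  map_smul' r x := by
    refine Prod.ext ?_ (Prod.ext ?_ ?_)
    · simp only [Prod.smul_fst, Prod.smul_snd, RingHom.id_apply, smul_eq_mul]; module
    · simp only [Prod.smul_fst, Prod.smul_snd, RingHom.id_apply, smul_eq_mul, inner_smul_left,
        RCLike.conj_to_real]
      ring
    · simp
  invFun x := (x.1 - x.2.2 • u, x.2.1 - x.2.2 / 2 * ⟪u, u⟫_ℝ + ⟪x.1, u⟫_ℝ, x.2.2)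
  left_inv x := by
    refine Prod.ext ?_ (Prod.ext ?_ ?_)
    · simp
    · simp only [inner_add_left, inner_smul_left, RCLike.conj_to_real]; ring
    · simp
  right_inv x := by
    refine Prod.ext ?_ (Prod.ext ?_ ?_)
    · simp
    · simp only [inner_sub_left, inner_smul_left, RCLike.conj_to_real]; ring
    · simp

theorem hatTranslation_apply (u : V) (x : VHat V) : hatTranslation u x =
    (x.1 + x.2.2 • u, x.2.1 - x.2.2 / 2 * ⟪u, u⟫_ℝ - ⟪x.1, u⟫_ℝ, x.2.2) := rfl

theorem hatTranslation_form (u : V) (x y : VHat V) :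
    hatForm (hatTranslation u x) (hatTranslation u y) = hatForm x y := by
  simp only [hatTranslation_apply, hatForm_apply, inner_add_left, inner_add_right,
    inner_smul_left, inner_smul_right, RCLike.conj_to_real, real_inner_comm u]
  ring

variable (V) in
/-- The open half space `V̂⁺ = V ⊕ ℝc ⊕ ℝ_{>0}d`. -/
def VHatPos : Set (VHat V) := {x | 0 < x.2.2}

theorem isOpen_VHatPos : IsOpen (VHatPos V) :=
  isOpen_lt continuous_const (continuous_snd.comp continuous_snd)

end Space

/-! ### The affine root system and the affine Weyl groups -/

/-- The root data: an orthogonal decomposition `V = V_s ⊕ V_sᗮ` of a Euclidean space, a reduced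
irreducible crystallographic root system in `V_s` whose coroots are `α^∨ = 2α/(α, α)` with respect
to the scalar product of `V`, a base of simple roots, its highest root `θ`, and a lattice `Y ⊂ V`
that contains all coroots and has integral scalar products with all roots. -/
structure AffineRootDatum (ι V : Type*) [NormedAddCommGroup V] [InnerProductSpace ℝ V] where
  Vs : Submodule ℝ V
  P : RootPairing ι ℝ Vs (Module.Dual ℝ Vs)
  isRootSystem : P.IsRootSystem
  isCrystallographic : P.IsCrystallographic
  isReduced : P.IsReduced
  isIrreducible : P.IsIrreducible
  coroot'_eq : ∀ (i : ι) (x : Vs),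
    P.coroot' i x = 2 * ⟪(x : V), (P.root i : V)⟫_ℝ / ⟪(P.root i : V), (P.root i : V)⟫_ℝ
  base : P.Base
  θ : ι
  highest : ∀ i, P.root θ - P.root i ∈ AddSubmonoid.closure (P.root '' base.support)
  Y : AddSubgroup V
  discrete : DiscreteTopology Y
  coroot_mem : ∀ i,
    (2 / ⟪(P.root i : V), (P.root i : V)⟫_ℝ) • (P.root i : V) ∈ Y
  integral : ∀ y ∈ Y, ∀ i, ∃ m : ℤ, ⟪y, (P.root i : V)⟫_ℝ = m

namespace AffineRootDatum

section Roots

variable {ι V : Type*} [NormedAddCommGroup V] [InnerProductSpace ℝ V]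
  (D : AffineRootDatum ι V)

/-- The roots, as vectors of `V`. -/
def α (i : ι) : V := (D.P.root i : V)

/-- The affine root `α_i + m c`. -/
def affineRoot (i : ι) (m : ℤ) : VHat V := (D.α i, (m : ℝ), 0)

/-- The affine root system `R̂ = R + ℤc`. -/
def affineRoots : Set (VHat V) := {a | ∃ (i : ι) (m : ℤ), a = D.affineRoot i m}

/-- The simple affine roots `F̂ = {a₀} ∪ F`, where `a₀ = -θ + c`. -/
def simpleAffineRoots : Set (VHat V) :=
  {a | a = (-D.α D.θ, 1, 0) ∨ ∃ i ∈ D.base.support, a = (D.α i, 0, 0)}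

/-- The affine Weyl group `Ŵ`, generated by the reflections in the affine roots. -/
def affineWeyl : Subgroup (VHat V ≃ₗ[ℝ] VHat V) :=
  Subgroup.closure {g | ∃ a ∈ D.affineRoots, g = hatReflection a}

/-- The extended affine Weyl group `Ŵ^Y = W ⋉ Y`, generated by the reflections in the roots
`α ∈ R` and by the `t_y`, `y ∈ Y`. -/
def extWeyl : Subgroup (VHat V ≃ₗ[ℝ] VHat V) :=
  Subgroup.closure
    ({g | ∃ i, g = hatReflection (D.α i, 0, 0)} ∪ {g | ∃ y ∈ D.Y, g = hatTranslation y})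

theorem α_ne_zero (i : ι) : D.α i ≠ 0 := by
  have := D.P.ne_zero i
  simpa [α] using this

theorem inner_α_ne_zero (i : ι) : ⟪D.α i, D.α i⟫_ℝ ≠ 0 := by
  simpa using D.α_ne_zero i

theorem exists_neg (i : ι) : ∃ j, D.α j = - D.α i := by
  refine ⟨D.P.reflectionPerm i i, ?_⟩
  have h := D.P.reflectionPerm_root i i
  rw [D.P.root_coroot_two] at h
  have h' := congrArg (Subtype.val) h
  simp only [α, ← h', Submodule.coe_sub, Submodule.coe_smul]
  module

theorem exists_refl (i j : ι) :
    ∃ l, D.α l = D.α j - (2 / ⟪D.α i, D.α i⟫_ℝ * ⟪D.α j, D.α i⟫_ℝ) • D.α i := by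
  refine ⟨D.P.reflectionPerm i j, ?_⟩
  have h := D.P.reflectionPerm_root i j
  have h2 := D.coroot'_eq i (D.P.root j)
  have h3 : D.P.toLinearMap (D.P.root j) (D.P.coroot i) =
      2 / ⟪D.α i, D.α i⟫_ℝ * ⟪D.α j, D.α i⟫_ℝ := by
    rw [show D.P.toLinearMap (D.P.root j) (D.P.coroot i) = D.P.coroot' i (D.P.root j) from rfl, h2]
    simp only [α]; ring
  rw [h3] at h
  have h' := congrArg (Subtype.val) h
  exact h'.symm

theorem simple_subset : D.simpleAffineRoots ⊆ D.affineRoots := by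
  rintro a (rfl | ⟨i, -, rfl⟩)
  · obtain ⟨j, hj⟩ := D.exists_neg D.θ
    exact ⟨j, 1, by simp [affineRoot, hj]⟩
  · exact ⟨i, 0, by simp [affineRoot]⟩

/-- `s_{α + mc} = s_α t_{mα^∨}`. -/
theorem hatReflection_affineRoot (i : ι) (m : ℤ) :
    hatReflection (D.affineRoot i m) = hatReflection (D.α i, 0, 0) *
      hatTranslation ((m : ℝ) • (2 / ⟪D.α i, D.α i⟫_ℝ) • D.α i) := by
  have h := D.inner_α_ne_zero i
  ext x : 1
  refine Prod.ext ?_ (Prod.ext ?_ ?_)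
  · simp only [LinearEquiv.mul_apply, hatReflection_apply, hatTranslation_apply, affineRoot,
      hatCheck, hatForm_apply, map_smul, Prod.fst_sub, Prod.smul_fst, smul_eq_mul,
      inner_add_left, inner_smul_left, RCLike.conj_to_real]
    simp only [mul_zero, zero_mul, add_zero]
    generalize ⟪D.α i, D.α i⟫_ℝ = q at h
    match_scalars <;> field_simp <;> ring
  · simp only [LinearEquiv.mul_apply, hatReflection_apply, hatTranslation_apply, affineRoot,
      hatCheck, hatForm_apply, map_smul, Prod.snd_sub, Prod.fst_sub, Prod.smul_fst, Prod.smul_snd,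
      smul_eq_mul, inner_add_left, inner_smul_left, inner_smul_right, RCLike.conj_to_real]
    simp only [mul_zero, zero_mul, add_zero]
    generalize ⟪D.α i, D.α i⟫_ℝ = q at h
    field_simp
    ring
  · simp [LinearEquiv.mul_apply, hatReflection_apply, hatTranslation_apply, affineRoot]

theorem reflection_mem_extWeyl {a : VHat V} (ha : a ∈ D.affineRoots) :
    hatReflection a ∈ D.extWeyl := by
  obtain ⟨i, m, rfl⟩ := ha
  rw [hatReflection_affineRoot]
  refine mul_mem (Subgroup.subset_closure (Or.inl ⟨i, rfl⟩))
    (Subgroup.subset_closure (Or.inr ⟨_, ?_, rfl⟩))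
  have := D.Y.zsmul_mem (D.coroot_mem i) m
  rwa [← Int.cast_smul_eq_zsmul ℝ] at this

theorem affineWeyl_le : D.affineWeyl ≤ D.extWeyl := by
  rw [affineWeyl, Subgroup.closure_le]
  rintro _ ⟨a, ha, rfl⟩
  exact D.reflection_mem_extWeyl ha

/-- The reflection `s_a`, `a ∈ R̂`, as an element of the affine Weyl group. -/
def s (a : D.affineRoots) : D.affineWeyl :=
  ⟨hatReflection a, Subgroup.subset_closure ⟨a, a.2, rfl⟩⟩

/-- The inclusion of the affine Weyl group in the extended affine Weyl group. -/
def incl : D.affineWeyl →* D.extWeyl := Subgroup.inclusion D.affineWeyl_le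

/-- `Ŵ^Y` preserves the bilinear form, the `d`-coordinate and the set of affine roots. -/
theorem extWeyl_props {g : VHat V ≃ₗ[ℝ] VHat V} (hg : g ∈ D.extWeyl) :
    (∀ x y, hatForm (g x) (g y) = hatForm x y) ∧ (∀ x, (g x).2.2 = x.2.2) ∧
      (∀ a, g a ∈ D.affineRoots ↔ a ∈ D.affineRoots) := by
  have key : ∀ g : VHat V ≃ₗ[ℝ] VHat V, (∀ a ∈ D.affineRoots, g a ∈ D.affineRoots) →
      (∀ a ∈ D.affineRoots, g.symm a ∈ D.affineRoots) →
      ∀ a, g a ∈ D.affineRoots ↔ a ∈ D.affineRoots := fun g h1 h2 a =>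
    ⟨fun h => by simpa using h2 _ h, h1 a⟩
  induction hg using Subgroup.closure_induction with
  | mem g hg =>
    rcases hg with ⟨i, rfl⟩ | ⟨y, hy, rfl⟩
    · refine ⟨hatReflection_form _, fun x => by simp [hatReflection_apply], ?_⟩
      have h1 : ∀ a ∈ D.affineRoots, hatReflection (D.α i, 0, 0) a ∈ D.affineRoots := by
        rintro _ ⟨j, m, rfl⟩
        obtain ⟨l, hl⟩ := D.exists_refl i j
        refine ⟨l, m, ?_⟩
        simp [hatReflection_apply, affineRoot, hl, hatCheck, hatForm_apply, inner_smul_right]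
      exact key _ h1 h1
    · refine ⟨hatTranslation_form _, fun x => rfl, key _ ?_ ?_⟩
      · rintro _ ⟨j, m, rfl⟩
        obtain ⟨n, hn⟩ := D.integral y hy j
        refine ⟨j, m - n, ?_⟩
        have : ⟪D.α j, y⟫_ℝ = n := by rw [real_inner_comm]; exact hn
        simp [hatTranslation_apply, affineRoot, this]
      · rintro _ ⟨j, m, rfl⟩
        obtain ⟨n, hn⟩ := D.integral y hy j
        refine ⟨j, m + n, ?_⟩
        have : ⟪D.α j, y⟫_ℝ = n := by rw [real_inner_comm]; exact hn
        rw [LinearEquiv.symm_apply_eq]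
        simp [hatTranslation_apply, affineRoot, this]
  | one => simp
  | mul g h _ _ hg hh =>
    exact ⟨fun x y => by simp [hg.1, hh.1], fun x => by simp [hg.2.1, hh.2.1],
      fun a => by simp [hg.2.2, hh.2.2]⟩
  | inv g _ hg =>
    refine ⟨fun x y => ?_, fun x => ?_, fun a => ?_⟩
    · have := hg.1 (g⁻¹ x) (g⁻¹ y)
      rwa [← LinearEquiv.mul_apply, ← LinearEquiv.mul_apply, mul_inv_cancel, eq_comm] at this
    · have := hg.2.1 (g⁻¹ x)
      rwa [← LinearEquiv.mul_apply, mul_inv_cancel, eq_comm] at this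
    · have := hg.2.2 (g⁻¹ a)
      rwa [← LinearEquiv.mul_apply, mul_inv_cancel, Iff.comm] at this

/-- A multiplicity function: a complex function on `R̂` that is invariant under `Ŵ^Y`. -/
def IsMultiplicityFunction (k : D.affineRoots → ℂ) : Prop :=
  ∀ (w : D.extWeyl) (a b : D.affineRoots),
    (b : VHat V) = (w : VHat V ≃ₗ[ℝ] VHat V) a → k b = k a

/-! ### Chambers -/

/-- The regular elements of `V̂⁺`. -/
def regular : Set (VHat V) := {x ∈ VHatPos V | ∀ a ∈ D.affineRoots, hatForm a x ≠ 0}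

/-- The set of chambers: the connected components of the regular set. -/
def Chamber : Type _ :=
  {C : Set (VHat V) // ∃ x ∈ D.regular, C = connectedComponentIn D.regular x}

/-- The fundamental chamber `Ĉ⁺`, as a subset of `V̂`. -/
def fundamental : Set (VHat V) := {x | ∀ a ∈ D.simpleAffineRoots, 0 < hatForm a x}

theorem map_regular (w : D.extWeyl) :
    (w : VHat V ≃ₗ[ℝ] VHat V) '' D.regular = D.regular := by
  have h : ∀ g ∈ D.extWeyl, ∀ x ∈ D.regular, g x ∈ D.regular := by
    intro g hg x hx
    obtain ⟨h1, h2, h3⟩ := D.extWeyl_props hg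
    refine ⟨?_, fun a ha => ?_⟩
    · have := hx.1
      simpa [VHatPos, h2] using this
    · have hb : g.symm a ∈ D.affineRoots := by rw [← h3]; simpa using ha
      have := hx.2 _ hb
      rwa [← h1, LinearEquiv.apply_symm_apply] at this
  refine Set.Subset.antisymm ?_ fun x hx => ?_
  · rintro _ ⟨x, hx, rfl⟩
    exact h _ w.2 x hx
  · exact ⟨_, h _ (inv_mem w.2) x hx, by rw [← LinearEquiv.mul_apply, mul_inv_cancel]; rfl⟩

theorem closure_coe {v : D.Vs} (hv : v ∈ AddSubmonoid.closure (D.P.root '' D.base.support)) :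
    ((v : V), (0 : ℝ), (0 : ℝ)) ∈ AddSubmonoid.closure D.simpleAffineRoots := by
  induction hv using AddSubmonoid.closure_induction with
  | mem v hv =>
    obtain ⟨i, hi, rfl⟩ := hv
    exact AddSubmonoid.subset_closure (Or.inr ⟨i, hi, rfl⟩)
  | zero => exact zero_mem _
  | add v u _ _ hv hu => simpa using add_mem hv hu

theorem highest_mem : D.P.root D.θ ∈ AddSubmonoid.closure (D.P.root '' D.base.support) := by
  rcases D.base.root_mem_or_neg_mem D.θ with h | h
  · exact h
  · have hl : (D.base.support : Set ι).Nonempty := by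
      by_contra hne
      rw [Set.not_nonempty_iff_eq_empty] at hne
      rw [hne] at h
      simp [D.P.ne_zero] at h
    obtain ⟨i, hi⟩ := hl
    have := add_mem (D.highest i) (AddSubmonoid.subset_closure (Set.mem_image_of_mem _ hi))
    simpa using this

/-- Every affine root is a nonnegative or a nonpositive integral combination of simple ones. -/
theorem affineRoot_mem_closure {a : VHat V} (ha : a ∈ D.affineRoots) :
    a ∈ AddSubmonoid.closure D.simpleAffineRoots ∨
      -a ∈ AddSubmonoid.closure D.simpleAffineRoots := by
  have hpos : ∀ (i : ι) (n : ℕ),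
      (D.α i, ((n : ℝ) + 1), (0 : ℝ)) ∈ AddSubmonoid.closure D.simpleAffineRoots := by
    intro i n
    obtain ⟨j, hj⟩ := D.exists_neg i
    have h0 : (-D.α D.θ, (1 : ℝ), (0 : ℝ)) ∈ AddSubmonoid.closure D.simpleAffineRoots :=
      AddSubmonoid.subset_closure (Or.inl rfl)
    have h1 := D.closure_coe D.highest_mem
    have h2 := D.closure_coe (D.highest j)
    have h3 := add_mem (add_mem (nsmul_mem h0 (n + 1)) (nsmul_mem h1 n)) h2
    convert h3 using 1
    refine Prod.ext ?_ (Prod.ext ?_ ?_)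
    · simp only [α] at hj
      simp only [α, Prod.fst_add, Prod.smul_fst, Submodule.coe_sub, hj]
      module
    · simp
    · simp
  obtain ⟨i, m, rfl⟩ := ha
  rcases lt_trichotomy m 0 with hm | rfl | hm
  · right
    obtain ⟨n, rfl⟩ : ∃ n : ℕ, m = -((n : ℤ) + 1) := ⟨(-m - 1).toNat, by omega⟩
    obtain ⟨j, hj⟩ := D.exists_neg i
    have := hpos j n
    rw [hj] at this
    convert this using 1
    refine Prod.ext ?_ (Prod.ext ?_ ?_) <;> simp [affineRoot]
  · rcases D.base.root_mem_or_neg_mem i with h | h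
    · left
      simpa [affineRoot, α] using D.closure_coe h
    · right
      simpa [affineRoot, α] using D.closure_coe h
  · left
    obtain ⟨n, rfl⟩ : ∃ n : ℕ, m = (n : ℤ) + 1 := ⟨(m - 1).toNat, by omega⟩
    simpa [affineRoot] using hpos i n

theorem closure_form_pos {a x : VHat V} (hx : x ∈ D.fundamental)
    (ha : a ∈ AddSubmonoid.closure D.simpleAffineRoots) : a = 0 ∨ 0 < hatForm a x := by
  induction ha using AddSubmonoid.closure_induction with
  | mem a ha => exact Or.inr (hx a ha)
  | zero => exact Or.inl rfl
  | add a b _ _ ha hb =>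
    rcases ha with rfl | ha <;> rcases hb with rfl | hb
    · simp
    · simpa using Or.inr hb
    · simpa using Or.inr ha
    · right
      simpa using add_pos ha hb

theorem fundamental_subset : D.fundamental ⊆ D.regular := by
  intro x hx
  refine ⟨?_, fun a ha => ?_⟩
  · have h0 : (-D.α D.θ, (1 : ℝ), (0 : ℝ)) ∈ AddSubmonoid.closure D.simpleAffineRoots :=
      AddSubmonoid.subset_closure (Or.inl rfl)
    rcases D.closure_form_pos hx (add_mem h0 (D.closure_coe D.highest_mem)) with h | h
    · simp [Prod.ext_iff] at h
    · simpa [VHatPos, α, hatForm_apply] using h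
  · have hne : a ≠ 0 := by
      obtain ⟨i, m, rfl⟩ := ha
      intro h
      exact D.α_ne_zero i (congrArg Prod.fst h)
    rcases D.affineRoot_mem_closure ha with h | h
    · rcases D.closure_form_pos hx h with h | h
      · exact absurd h hne
      · exact h.ne'
    · rcases D.closure_form_pos hx h with h | h
      · exact absurd (neg_eq_zero.mp h) hne
      · rw [map_neg, LinearMap.neg_apply, neg_pos] at h
        exact h.ne

theorem fundamental_nonempty [FiniteDimensional ℝ V] : D.fundamental.Nonempty := by
  have hli : LinearIndependent ℝ (fun i : D.base.support => D.P.root i) :=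
    D.base.linearIndepOn_root
  have hli' : LinearIndependent ℝ (fun i : D.base.support => D.α i) :=
    hli.map' D.Vs.subtype (Submodule.ker_subtype _)
  obtain ⟨f, hf⟩ : ∃ f : V →ₗ[ℝ] ℝ, ∀ i : D.base.support, f (D.α i) = 1 := by
    let b := Module.Basis.extend hli'.linearIndepOn_id
    refine ⟨b.constr ℝ (fun _ => (1 : ℝ)), fun i => ?_⟩
    have hi : D.α i ∈ hli'.linearIndepOn_id.extend (Set.subset_univ _) :=
      LinearIndepOn.subset_extend _ _ ⟨i, rfl⟩
    have : b ⟨_, hi⟩ = D.α i := by simp [b]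
    rw [← this, b.constr_basis]
  let v := (InnerProductSpace.toDual ℝ V).symm (LinearMap.toContinuousLinearMap f)
  have hv : ∀ u, ⟪u, v⟫_ℝ = f u := fun u => by
    rw [real_inner_comm, InnerProductSpace.toDual_symm_apply]; rfl
  refine ⟨(v, 0, f (D.α D.θ) + 1), ?_⟩
  rintro a (rfl | ⟨i, hi, rfl⟩)
  · simp [hatForm_apply, hv]
  · have := hf ⟨i, hi⟩
    simp [hatForm_apply, hv, this]

theorem continuous_hatForm [FiniteDimensional ℝ V] (a : VHat V) :
    Continuous fun x => hatForm a x :=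
  LinearMap.continuous_of_finiteDimensional (hatForm a)

theorem fundamental_component [FiniteDimensional ℝ V] [Finite ι] {x : VHat V}
    (hx : x ∈ D.fundamental) : D.fundamental = connectedComponentIn D.regular x := by
  have hfin : D.simpleAffineRoots.Finite := by
    have : D.simpleAffineRoots ⊆
        insert (-D.α D.θ, 1, 0) (Set.range fun i => (D.α i, (0 : ℝ), (0 : ℝ))) := by
      rintro a (rfl | ⟨i, -, rfl⟩)
      · exact Set.mem_insert _ _
      · exact Set.mem_insert_of_mem _ ⟨i, rfl⟩
    exact ((Set.finite_range _).insert _).subset this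
  have hopen : IsOpen D.fundamental := by
    have : D.fundamental = ⋂ a ∈ D.simpleAffineRoots, {x | 0 < hatForm a x} := by
      ext x; simp [fundamental]
    rw [this]
    exact hfin.isOpen_biInter fun a _ => isOpen_lt continuous_const (continuous_hatForm a)
  have hconv : Convex ℝ D.fundamental := by
    intro y hy z hz s t hs ht hst a ha
    have h1 := hy a ha
    have h2 := hz a ha
    simp only [map_add, map_smul, smul_eq_mul]
    rcases hs.eq_or_lt with rfl | hs
    · have : t = 1 := by linarith
      subst this
      simpa using h2
    · have := mul_pos hs h1
      have := mul_nonneg ht h2.le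
      linarith
  refine Set.Subset.antisymm
    (hconv.isPreconnected.subset_connectedComponentIn hx D.fundamental_subset) ?_
  have hopen' : IsOpen (⋃ a ∈ D.simpleAffineRoots, {x : VHat V | hatForm a x < 0}) :=
    isOpen_biUnion fun a _ => isOpen_lt (continuous_hatForm a) continuous_const
  refine isPreconnected_connectedComponentIn.subset_left_of_subset_union hopen hopen' ?_ ?_
    ⟨x, mem_connectedComponentIn (D.fundamental_subset hx), hx⟩
  · rw [Set.disjoint_left]
    intro y hy hy'
    simp only [Set.mem_iUnion, Set.mem_ofPred_eq] at hy'
    obtain ⟨a, ha, h⟩ := hy'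
    exact lt_asymm h (hy a ha)
  · intro y hy
    have hy := connectedComponentIn_subset _ _ hy
    by_cases h : y ∈ D.fundamental
    · exact Or.inl h
    · right
      simp only [fundamental, Set.mem_ofPred_eq, not_forall, not_lt] at h
      obtain ⟨a, ha, h⟩ := h
      simp only [Set.mem_iUnion, Set.mem_ofPred_eq]
      exact ⟨a, ha, lt_of_le_of_ne h (hy.2 a (D.simple_subset ha))⟩

/-- The chamber `w Ĉ⁺`, `w ∈ Ŵ^Y`. -/
def chamber [FiniteDimensional ℝ V] [Finite ι] (w : D.extWeyl) : D.Chamber :=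
  ⟨(w : VHat V ≃ₗ[ℝ] VHat V) '' D.fundamental, by
    obtain ⟨x, hx⟩ := D.fundamental_nonempty
    have hr := D.fundamental_subset hx
    refine ⟨(w : VHat V ≃ₗ[ℝ] VHat V) x, ?_, ?_⟩
    · rw [← D.map_regular w]
      exact Set.mem_image_of_mem _ hr
    · have h := (w : VHat V ≃ₗ[ℝ] VHat V).toContinuousLinearEquiv.toHomeomorph
        |>.image_connectedComponentIn hr
      rw [D.fundamental_component hx]
      conv_rhs => rw [← D.map_regular w]
      exact h⟩

end Roots

end AffineRootDatum

/-! ### Analytic functions and constant coefficient differential operators -/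

section Analytic

variable (V M : Type*) [NormedAddCommGroup V] [InnerProductSpace ℝ V]
  [NormedAddCommGroup M] [NormedSpace ℂ M]

/-- The space `C^ω(V̂⁺) ⊗ M` of real analytic `M`-valued functions on `V̂⁺`, where `M` is finite
dimensional. A function on `V̂⁺` is represented by its extension by zero to `V̂`. -/
def AnalyticSpace : Submodule ℂ (VHat V → M) where
  carrier := {f | AnalyticOnNhd ℝ f (VHatPos V) ∧ ∀ x ∉ VHatPos V, f x = 0}
  add_mem' hf hg := ⟨hf.1.add hg.1, fun x hx => by simp [hf.2 x hx, hg.2 x hx]⟩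
  zero_mem' := ⟨analyticOnNhd_const, fun _ _ => rfl⟩
  smul_mem' r f hf := ⟨(show AnalyticOnNhd ℝ (fun _ : VHat V => r) (VHatPos V) from
    analyticOnNhd_const).smul hf.1, fun x hx => by simp [hf.2 x hx]⟩

variable {V M} [FiniteDimensional ℂ M]

theorem analytic_indicator {f : VHat V → M} (hf : AnalyticOnNhd ℝ f (VHatPos V)) :
    Set.indicator (VHatPos V) f ∈ AnalyticSpace V M := by
  refine ⟨fun x hx => (hf x hx).congr ?_, fun x hx => Set.indicator_of_notMem hx _⟩
  filter_upwards [isOpen_VHatPos.mem_nhds hx] with y hy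
  rw [Set.indicator_of_mem hy]

theorem analytic_fderiv (f : AnalyticSpace V M) (u : VHat V) :
    AnalyticOnNhd ℝ (fun x => fderiv ℝ f.1 x u) (VHatPos V) := by
  have : CompleteSpace M := FiniteDimensional.complete ℂ M
  exact fun x hx => ((ContinuousLinearMap.apply ℝ M u).analyticAt _).fun_comp (f.2.1.fderiv x hx)

theorem differentiableAt_analytic (f : AnalyticSpace V M) {x : VHat V}
    (hx : x ∈ VHatPos V) : DifferentiableAt ℝ f.1 x :=
  (f.2.1 x hx).differentiableAt

/-- The directional derivative `∂_u` on `C^ω(V̂⁺) ⊗ M`, `u ∈ V̂`. -/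
def partialD (u : VHat V) : Module.End ℂ (AnalyticSpace V M) where
  toFun f := ⟨Set.indicator (VHatPos V) (fun x => fderiv ℝ f.1 x u),
    analytic_indicator (analytic_fderiv f u)⟩
  map_add' f g := by
    ext x
    by_cases hx : x ∈ VHatPos V
    · have h := fderiv_add (differentiableAt_analytic f hx) (differentiableAt_analytic g hx)
      simp [hx, h]
    · simp [hx]
  map_smul' r f := by
    ext x
    by_cases hx : x ∈ VHatPos V
    · have h := fderiv_const_smul (differentiableAt_analytic f hx) r
      simp [hx, h]
    · simp [hx]

theorem partialD_apply (u : VHat V) (f : AnalyticSpace V M) {x : VHat V} (hx : x ∈ VHatPos V) :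
    (partialD u f).1 x = fderiv ℝ f.1 x u :=
  Set.indicator_of_mem (f := fun x => fderiv ℝ f.1 x u) hx

theorem partialD_comm (u v : VHat V) :
    (partialD u * partialD v : Module.End ℂ (AnalyticSpace V M)) = partialD v * partialD u := by
  have : CompleteSpace M := FiniteDimensional.complete ℂ M
  have key : ∀ (u v : VHat V) (f : AnalyticSpace V M) (x : VHat V), x ∈ VHatPos V →
      (partialD u (partialD v f)).1 x = fderiv ℝ (fderiv ℝ f.1) x u v := by
    intro u v f x hx
    rw [partialD_apply u _ hx]
    have h1 : (partialD v f).1 =ᶠ[𝓝 x] fun y => fderiv ℝ f.1 y v := by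
      filter_upwards [isOpen_VHatPos.mem_nhds hx] with y hy
      exact partialD_apply v f hy
    rw [h1.fderiv_eq]
    have h2 : DifferentiableAt ℝ (fderiv ℝ f.1) x := (f.2.1.fderiv x hx).differentiableAt
    rw [fderiv_clm_apply h2 (differentiableAt_const v)]
    simp
  ext f x
  by_cases hx : x ∈ VHatPos V
  · change (partialD u (partialD v f)).1 x = (partialD v (partialD u f)).1 x
    rw [key u v f x hx, key v u f x hx]
    exact (f.2.1 x hx).contDiffAt.isSymmSndFDerivAt_of_omega u v
  · change (partialD u (partialD v f)).1 x = (partialD v (partialD u f)).1 x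
    rw [(partialD u (partialD v f)).2.2 x hx, (partialD v (partialD u f)).2.2 x hx]

variable (V) in
/-- The complexification `ĥ = ℂ ⊗ V̂`. -/
abbrev HHat : Type _ := ℂ ⊗[ℝ] VHat V

variable (V) in
/-- The symmetric algebra `S(ĥ)`. -/
abbrev SHat : Type _ := SymmetricAlgebra ℂ (HHat V)

/-- The element of degree one of `S(ĥ)` given by `u ∈ V̂`. -/
def deg1 (u : VHat V) : SHat V := SymmetricAlgebra.ι ℂ (HHat V) (1 ⊗ₜ u)

variable (V M) in
/-- `u ↦ ∂_u` for `u ∈ V̂`. -/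
def partialR : VHat V →ₗ[ℝ] Module.End ℂ (AnalyticSpace V M) where
  toFun := partialD
  map_add' u v := by
    ext f x
    by_cases hx : x ∈ VHatPos V <;> simp [partialD, hx]
  map_smul' r u := by
    ext f x
    by_cases hx : x ∈ VHatPos V <;> simp [partialD, hx]

variable (V M) in
/-- `u ↦ ∂_u` for `u ∈ ĥ`. -/
def partialC : HHat V →ₗ[ℂ] Module.End ℂ (AnalyticSpace V M) :=
  (partialR V M).liftBaseChange ℂ

theorem partialC_comm (u v : HHat V) :
    partialC V M u * partialC V M v = partialC V M v * partialC V M u := by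
  induction u using TensorProduct.induction_on with
  | zero => simp
  | add u u' hu hu' => simp only [map_add, add_mul, mul_add, hu, hu']
  | tmul r u =>
    induction v using TensorProduct.induction_on with
    | zero => simp
    | add v v' hv hv' => simp only [map_add, add_mul, mul_add, hv, hv']
    | tmul t v =>
      have h := partialD_comm (M := M) u v
      simp only [partialC, LinearMap.liftBaseChange_tmul, smul_mul_assoc, mul_smul_comm]
      rw [smul_comm]
      congr 2

/-- The subalgebra generated by the pairwise commuting values of `g` is commutative. -/
abbrev adjoinCommSemiring {E A : Type*} [AddCommMonoid E] [Module ℂ E] [Semiring A] [Algebra ℂ A]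
    (g : E →ₗ[ℂ] A) (hg : ∀ u v, g u * g v = g v * g u) :
    CommSemiring (Algebra.adjoin ℂ (Set.range g)) :=
  { (inferInstance : Semiring (Algebra.adjoin ℂ (Set.range g))) with
    mul_comm := (Algebra.isMulCommutative_adjoin ℂ
      (by rintro _ ⟨u, rfl⟩ _ ⟨v, rfl⟩; exact hg u v)).is_comm.comm }

/-- A linear map with pairwise commuting values in an algebra `A` extends to an algebra
homomorphism from the symmetric algebra to `A`. -/
def symLift {E A : Type*} [AddCommMonoid E] [Module ℂ E] [Semiring A] [Algebra ℂ A] (g : E →ₗ[ℂ] A)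
    (hg : ∀ u v, g u * g v = g v * g u) : SymmetricAlgebra ℂ E →ₐ[ℂ] A :=
  letI := adjoinCommSemiring g hg
  (Algebra.adjoin ℂ (Set.range g)).val.comp
    (SymmetricAlgebra.lift
      (g.codRestrict (Subalgebra.toSubmodule (Algebra.adjoin ℂ (Set.range g)))
        (fun u => Algebra.subset_adjoin ⟨u, rfl⟩)))

theorem symLift_ι {E A : Type*} [AddCommMonoid E] [Module ℂ E] [Semiring A] [Algebra ℂ A]
    (g : E →ₗ[ℂ] A) (hg : ∀ u v, g u * g v = g v * g u) (u : E) :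
    symLift g hg (SymmetricAlgebra.ι ℂ E u) = g u := by
  letI := adjoinCommSemiring g hg
  simp only [symLift, AlgHom.comp_apply]
  rw [SymmetricAlgebra.lift_ι_apply]
  rfl

variable (V M) in
/-- The constant coefficient differential operator `p(∂)` attached to `p ∈ S(ĥ)`: the algebra
homomorphism `S(ĥ) → End(C^ω(V̂⁺) ⊗ M)` that sends `u ∈ ĥ` to `∂_u`. -/
def diffOp : SHat V →ₐ[ℂ] Module.End ℂ (AnalyticSpace V M) :=
  symLift (partialC V M) partialC_comm

theorem diffOp_deg1 (u : VHat V) : diffOp V M (deg1 u) = partialD u := by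
  rw [diffOp, deg1, symLift_ι]
  simp [partialC, partialR]

/-- The action of a linear automorphism `g` of `V̂` on `S(ĥ)` by algebra automorphisms. -/
def symAct (g : VHat V ≃ₗ[ℝ] VHat V) : SHat V →ₐ[ℂ] SHat V :=
  SymmetricAlgebra.lift (SymmetricAlgebra.ι ℂ (HHat V) ∘ₗ (g : VHat V →ₗ[ℝ] VHat V).baseChange ℂ)

theorem check_dvd (b : VHat V) (p : SHat V) :
    deg1 (hatCheck b) ∣ symAct (hatReflection b) p - p := by
  induction p using SymmetricAlgebra.induction with
  | algebraMap r => simp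
  | ι x =>
    induction x using TensorProduct.induction_on with
    | zero => simp
    | add x y hx hy =>
      simp only [map_add]
      convert dvd_add hx hy using 1
      ring
    | tmul r x =>
      refine ⟨algebraMap ℂ _ (-(r * (hatForm x b : ℂ))), ?_⟩
      have h1 : hatReflection b x - x = (-hatForm x b) • hatCheck b := by
        simp only [hatReflection_apply, hatCheck, map_smul, smul_eq_mul]
        module
      have h2 : symAct (hatReflection b) (SymmetricAlgebra.ι ℂ (HHat V) (r ⊗ₜ x)) =
          SymmetricAlgebra.ι ℂ (HHat V) (r ⊗ₜ hatReflection b x) := by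
        simp [symAct]
      rw [h2, ← map_sub, ← TensorProduct.tmul_sub, h1, mul_comm, ← Algebra.smul_def, deg1,
        ← map_smul, TensorProduct.smul_tmul', ← TensorProduct.smul_tmul]
      congr 2
      simp [mul_comm]
  | mul p q hp hq =>
    have : symAct (hatReflection b) (p * q) - p * q =
        symAct (hatReflection b) p * (symAct (hatReflection b) q - q) +
          (symAct (hatReflection b) p - p) * q := by rw [map_mul]; ring
    rw [this]
    exact dvd_add (dvd_mul_of_dvd_right hq _) (dvd_mul_of_dvd_left hp _)
  | add p q hp hq =>
    rw [map_add]
    convert dvd_add hp hq using 1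
    ring

/-- The divided difference `Δ_b(p) = (s_b p - p)/b^∨ ∈ S(ĥ)`: the quotient in the integral domain
`S(ĥ)`, so `b^∨ · Δ_b(p) = s_b p - p` (used for `(b, b) ≠ 0`). -/
def dividedDiff (b : VHat V) (p : SHat V) : SHat V :=
  (check_dvd b p).choose

theorem dividedDiff_spec (b : VHat V) (p : SHat V) :
    deg1 (hatCheck b) * dividedDiff b p = symAct (hatReflection b) p - p :=
  (check_dvd b p).choose_spec.symm

end Analytic

/-! ### The integral-reflection operators and the propagation operator -/

namespace AffineRootDatum

section Propagation

variable {ι V M : Type*} [NormedAddCommGroup V] [InnerProductSpace ℝ V]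
  [NormedAddCommGroup M] [NormedSpace ℂ M]
  (D : AffineRootDatum ι V)

variable [FiniteDimensional ℝ V] [FiniteDimensional ℂ M] (π : Representation ℂ D.extWeyl M)

/-- The action `w ⊗ π_M(w)` of `w ∈ Ŵ^Y` on `C^ω(V̂⁺) ⊗ M`, i.e.
`f ↦ (x ↦ π_M(w) (f (w⁻¹ x)))`. -/
def act (w : D.extWeyl) : Module.End ℂ (AnalyticSpace V M) where
  toFun f := ⟨fun x => π w (f.1 ((w⁻¹ : D.extWeyl).1 x)), by
    have hd : ∀ x, ((w⁻¹ : D.extWeyl).1 x).2.2 = x.2.2 := (D.extWeyl_props (w⁻¹).2).2.1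
    refine ⟨fun x hx => ?_, fun x hx => ?_⟩
    · have h1 : AnalyticAt ℝ (fun x => (w⁻¹ : D.extWeyl).1 x) x :=
        (((w⁻¹ : D.extWeyl).1 : VHat V →ₗ[ℝ] VHat V).toContinuousLinearMap).analyticAt x
      have h2 : AnalyticAt ℝ f.1 ((w⁻¹ : D.extWeyl).1 x) := f.2.1 _ ((hd x).symm ▸ hx :
        0 < ((w⁻¹ : D.extWeyl).1 x).2.2)
      have h3 := ((LinearMap.toContinuousLinearMap (π w)).restrictScalars ℝ).analyticAt
        (f.1 ((w⁻¹ : D.extWeyl).1 x))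
      exact AnalyticAt.fun_comp (g := fun m => π w m) h3 (h2.fun_comp h1)
    · have h : (w⁻¹ : D.extWeyl).1 x ∉ VHatPos V := fun h => hx (show 0 < x.2.2 by
        rw [← hd x]; exact h)
      change π w (f.1 ((w⁻¹ : D.extWeyl).1 x)) = 0
      rw [f.2.2 _ h, map_zero]⟩
  map_add' f g := by ext x; simp
  map_smul' r f := by ext x; simp

/-- The defining formulas
`Q̂(s_a) = s_a ⊗ π_M(s_a) - k_a I(a) ⊗ Id_M` for the simple affine roots `a`, where
`(I(a)f)(x) = ∫_0^{(a, x)} f(x - t a^∨) dt`, for a representation of the affine Weyl group on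
`C^ω(V̂⁺) ⊗ M`. -/
def IsIntegralReflection (k : D.affineRoots → ℂ)
    (Q : Representation ℂ D.affineWeyl (AnalyticSpace V M)) : Prop :=
  ∀ a : D.affineRoots, (a : VHat V) ∈ D.simpleAffineRoots →
    ∀ (f : AnalyticSpace V M), ∀ x ∈ VHatPos V,
      (Q (D.s a) f).1 x = (D.act π (D.incl (D.s a)) f).1 x -
        k a • ∫ t in (0 : ℝ)..(hatForm (a : VHat V) x), f.1 (x - t • hatCheck (a : VHat V))

/-- The integral-reflection operators `Q̂(w)`, `w ∈ Ŵ`: the representation of `Ŵ` on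
`C^ω(V̂⁺) ⊗ M` given on the generators `s_a`, `a ∈ F̂`, by the integral-reflection formulas. It is
unique because the simple reflections generate `Ŵ`. -/
def Q (k : D.affineRoots → ℂ) : Representation ℂ D.affineWeyl (AnalyticSpace V M) :=
  @Classical.epsilon _ ⟨1⟩ (D.IsIntegralReflection π k)

variable [Finite ι]

/-- The element `w ∈ Ŵ` with `C = w Ĉ⁺`; it is unique, as `Ŵ` acts simply transitively on the
chambers. -/
def element (C : D.Chamber) : D.affineWeyl :=
  @Classical.epsilon _ ⟨1⟩ (fun w => C = D.chamber (D.incl w))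

/-- The propagation operator `T : C^ω(V̂⁺) ⊗ M → 𝓕_M = ∏_C (C^ω(V̂⁺) ⊗ M)`, the product being over
all chambers `C`:
`(T f)_{wĈ⁺}(x) = π_M(w) ((Q̂(w⁻¹) f)(w⁻¹ x))` for `w ∈ Ŵ`. -/
def T (k : D.affineRoots → ℂ) :
    AnalyticSpace V M →ₗ[ℂ] (D.Chamber → AnalyticSpace V M) :=
  LinearMap.pi fun C =>
    D.act π (D.incl (D.element C)) ∘ₗ D.Q π k (D.element C)⁻¹

end Propagation

end AffineRootDatum

end

/-! Let J_b = (s_b ⊗ π(s_b)) I(b), where I(b) is the integral operator. The heart is an identity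
between functions on the whole half space: f_C - f_{s_b C} = k_b J_b f_C for C = wĈ⁺ (`T_sub_T`).
Choose v in Ŵ with vĈ⁺ = wĈ⁺. Then v⁻¹w permutes the simple roots, so a = v⁻¹b is simple and s_b v =
v s_a. With g = Q̂(v⁻¹)f the two components of T f are v g and v s_a Q̂(s_a) g = v g - k_a v s_a
I(a) g; conjugation by v turns s_a I(a) into J_b, and k_a = k_b. To differentiate, one uses p(∂) J_b
= J_b (s_b p)(∂) + π(s_b) Δ_b(p)(∂) (`diffOp_jumpOp`), which holds in degree one and propagates by
the twisted Leibniz rule for Δ_b. On the wall (b, x) = 0 the first term vanishes, since its integral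
runs over a single point.

This needs Q̂(s_a) to be given by the integral-reflection formula, so the existence of the
representation Q̂ has to be proved; that is the longest part. Operators are defined along one
reduced expression of w, and independence of the expression (`QOpCompatible`) is proved by induction
on the length. The tool is a rigidity principle: an operator X with ∂_u X = X ∂_{τu}, all of whose
values vanish at one point, is zero, because all Taylor coefficients vanish there
(`eq_zero_of_partialD_comm`). If a and b are two descents of w, both candidate operators satisfy the
same `CrossRelation`, whose correction terms involve only the shorter elements s_γ w; so their
difference intertwines derivatives. At a point with (a, x) = (b, x) = 0 the operators of s_a and s_b
act through π, and both candidates reduce to the same π(g) and the same minimal coset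
representative. No braid relation is checked case by case. The combinatorics behind this (length as
number of inversions, deletion, minimal representatives, simple transitivity) comes from the sign
properties of affine roots. -/

namespace AffineRootDatum

/-! ### Positive affine roots and points on the faces of the fundamental chamber. -/

section Combinatorics

variable {ι V : Type*} [NormedAddCommGroup V] [InnerProductSpace ℝ V] (D : AffineRootDatum ι V)

/-- The positive affine roots: the affine roots that are sums of simple ones. -/
def posRoots : Set (VHat V) :=
  {a | a ∈ D.affineRoots ∧ a ∈ AddSubmonoid.closure D.simpleAffineRoots}

theorem neg_mem_affineRoots {a : VHat V} (ha : a ∈ D.affineRoots) : -a ∈ D.affineRoots := by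
  obtain ⟨i, m, rfl⟩ := ha
  obtain ⟨j, hj⟩ := D.exists_neg i
  exact ⟨j, -m, by simp [affineRoot, hj]⟩

theorem simple_pos {a : VHat V} (ha : a ∈ D.simpleAffineRoots) : a ∈ D.posRoots :=
  ⟨D.simple_subset ha, AddSubmonoid.subset_closure ha⟩

theorem pos_or_neg_pos {a : VHat V} (ha : a ∈ D.affineRoots) :
    a ∈ D.posRoots ∨ -a ∈ D.posRoots :=
  (D.affineRoot_mem_closure ha).imp (fun h => ⟨ha, h⟩) fun h => ⟨D.neg_mem_affineRoots ha, h⟩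

theorem hatForm_self_pos {a : VHat V} (ha : a ∈ D.affineRoots) : 0 < hatForm a a := by
  obtain ⟨i, m, rfl⟩ := ha
  have := D.α_ne_zero i
  simp only [hatForm_apply, affineRoot, mul_zero, zero_mul, add_zero, real_inner_self_eq_norm_sq]
  positivity

theorem ne_zero_of_mem_affineRoots {a : VHat V} (ha : a ∈ D.affineRoots) : a ≠ 0 := by
  rintro rfl
  simpa using D.hatForm_self_pos ha

theorem form_pos_of_mem_posRoots {a x : VHat V} (ha : a ∈ D.posRoots) (hx : x ∈ D.fundamental) :
    0 < hatForm a x :=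
  (D.closure_form_pos hx ha.2).resolve_left (D.ne_zero_of_mem_affineRoots ha.1)

/-- The forms `(a, ·)`, `a ∈ F̂`, take arbitrary prescribed values simultaneously. -/
theorem exists_form_eq [FiniteDimensional ℝ V] (φ : VHat V → ℝ) :
    ∃ x, ∀ a ∈ D.simpleAffineRoots, hatForm a x = φ a := by
  have hli : LinearIndependent ℝ (fun i : D.base.support => D.P.root i) :=
    D.base.linearIndepOn_root
  have hli' : LinearIndependent ℝ (fun i : D.base.support => D.α i) :=
    hli.map' D.Vs.subtype (Submodule.ker_subtype _)
  obtain ⟨f, hf⟩ : ∃ f : V →ₗ[ℝ] ℝ, ∀ i : D.base.support, f (D.α i) = φ (D.α i, 0, 0) := by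
    let b := Module.Basis.extend hli'.linearIndepOn_id
    refine ⟨b.constr ℝ (fun v => φ (v, 0, 0)), fun i => ?_⟩
    have hi : D.α i ∈ hli'.linearIndepOn_id.extend (Set.subset_univ _) :=
      LinearIndepOn.subset_extend _ _ ⟨i, rfl⟩
    have : b ⟨_, hi⟩ = D.α i := by simp [b]
    rw [← this, b.constr_basis]
    simp [b]
  let v := (InnerProductSpace.toDual ℝ V).symm (LinearMap.toContinuousLinearMap f)
  have hv : ∀ u, ⟪u, v⟫_ℝ = f u := fun u => by
    rw [real_inner_comm, InnerProductSpace.toDual_symm_apply]; rfl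
  -- Among the simple roots only a₀ sees the `d`-coordinate, so that coordinate can be adjusted
  -- after the values on F are fixed.
  refine ⟨(v, 0, f (D.α D.θ) + φ (-D.α D.θ, 1, 0)), ?_⟩
  rintro a (rfl | ⟨i, hi, rfl⟩)
  · simp [hatForm_apply, hv]
  · have := hf ⟨i, hi⟩
    simp [hatForm_apply, hv, this]

open Classical in
/-- A point at which the simple roots in `J` vanish and the other simple roots are positive. -/
theorem exists_face_point [FiniteDimensional ℝ V] (J : Set (VHat V)) :
    ∃ x, (∀ a ∈ D.simpleAffineRoots, a ∈ J → hatForm a x = 0) ∧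
      ∀ y ∈ AddSubmonoid.closure D.simpleAffineRoots, 0 ≤ hatForm y x ∧
        (hatForm y x = 0 → y ∈ AddSubmonoid.closure J) := by
  obtain ⟨x, hx⟩ := D.exists_form_eq fun a => if a ∈ J then 0 else 1
  refine ⟨x, fun a ha haJ => by simpa [haJ] using hx a ha, fun y hy => ?_⟩
  induction hy using AddSubmonoid.closure_induction with
  | mem a ha =>
    rw [hx a ha]
    split_ifs with h
    · exact ⟨le_rfl, fun _ => AddSubmonoid.subset_closure h⟩
    · exact ⟨zero_le_one, fun h => absurd h one_ne_zero⟩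
  | zero => simp
  | add a b _ _ ha hb =>
    simp only [map_add, LinearMap.add_apply]
    refine ⟨add_nonneg ha.1 hb.1, fun h => ?_⟩
    exact add_mem (ha.2 (by linarith [ha.1, hb.1])) (hb.2 (by linarith [ha.1, hb.1]))

/-- The null root `c` is a sum of simple affine roots. -/
theorem nullRoot_mem_closure :
    ((0 : V), (1 : ℝ), (0 : ℝ)) ∈ AddSubmonoid.closure D.simpleAffineRoots := by
  have h0 : (-D.α D.θ, (1 : ℝ), (0 : ℝ)) ∈ AddSubmonoid.closure D.simpleAffineRoots :=
    AddSubmonoid.subset_closure (Or.inl rfl)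
  simpa [α] using add_mem h0 (D.closure_coe D.highest_mem)

/-- The `d`-coordinate of x is (c, x), and c is a sum of simple roots; it is therefore nonnegative,
and zero only if c is a sum of elements of J. -/
theorem face_point_mem_VHatPos {J : Set (VHat V)} {x : VHat V}
    (hx : ∀ y ∈ AddSubmonoid.closure D.simpleAffineRoots, 0 ≤ hatForm y x ∧
        (hatForm y x = 0 → y ∈ AddSubmonoid.closure J))
    (hJ : ((0 : V), (1 : ℝ), (0 : ℝ)) ∉ AddSubmonoid.closure J) : x ∈ VHatPos V := by
  obtain ⟨h1, h2⟩ := hx _ D.nullRoot_mem_closure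
  have h3 : hatForm ((0 : V), (1 : ℝ), (0 : ℝ)) x = x.2.2 := by simp [hatForm_apply]
  rw [h3] at h1 h2
  exact lt_of_le_of_ne h1 fun h => hJ (h2 h.symm)

/-- If b = n a, the finite parts are proportional with factor n. Reducedness excludes n ≥ 2, and n =
0 would give a zero root. -/
theorem eq_of_mem_closure_singleton {a b : VHat V} (ha : a ∈ D.affineRoots)
    (hb : b ∈ D.affineRoots) (h : b ∈ AddSubmonoid.closure {a}) : b = a := by
  obtain ⟨n, rfl⟩ := AddSubmonoid.mem_closure_singleton.1 h
  obtain ⟨i, m, rfl⟩ := ha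
  obtain ⟨j, l, hj⟩ := hb
  have hr : n • D.P.root i = D.P.root j := by
    have := congrArg Prod.fst hj
    exact Subtype.ext (by simpa [affineRoot, α] using this)
  have := D.isReduced
  have : n = 1 := by
    by_contra hn
    rcases Nat.lt_or_ge n 2 with h2 | h2
    · have : n = 0 := by omega
      subst this
      exact D.P.ne_zero j (by simpa using hr.symm)
    · have : n.AtLeastTwo := ⟨h2⟩
      have : IsAddTorsionFree D.Vs := IsAddTorsionFree.of_isTorsionFree ℝ D.Vs
      have h3 := D.P.nsmul_notMem_range_root (n := n) (i := i)
      exact h3 ⟨j, hr.symm⟩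
  simp [this]

/-! ### Reflections -/

theorem hatForm_hatCheck_self {a : VHat V} (ha : hatForm a a ≠ 0) : hatForm a (hatCheck a) = 2 := by
  simp only [hatCheck, map_smul, smul_eq_mul]
  field_simp

theorem hatReflection_self {a : VHat V} (ha : hatForm a a ≠ 0) : hatReflection a a = -a := by
  rw [hatReflection_apply, hatForm_hatCheck_self ha]
  module

theorem hatReflection_mul_self (a : VHat V) : hatReflection a * hatReflection a = 1 := by
  ext x : 1
  exact (hatReflection a).left_inv x

theorem hatReflection_inv (a : VHat V) : (hatReflection a)⁻¹ = hatReflection a :=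
  inv_eq_of_mul_eq_one_left (hatReflection_mul_self a)

theorem hatReflection_hatReflection (a x : VHat V) : hatReflection a (hatReflection a x) = x :=
  (hatReflection a).left_inv x

theorem hatReflection_neg (a : VHat V) : hatReflection (-a) = hatReflection a := by
  ext x : 1
  simp [hatReflection_apply, hatCheck]

theorem hatReflection_of_form_eq_zero {a x : VHat V} (h : hatForm a x = 0) :
    hatReflection a x = x := by
  rw [hatReflection_apply, hatCheck, map_smul, hatForm_comm x a, h]
  simp

theorem hatForm_hatReflection_left (a x y : VHat V) :
    hatForm (hatReflection a x) y = hatForm x (hatReflection a y) := by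
  rw [← hatReflection_form a, hatReflection_hatReflection]

/-- `s_{g a} = g s_a g⁻¹` for `g` preserving the form. -/
theorem hatReflection_map {g : VHat V ≃ₗ[ℝ] VHat V}
    (hg : ∀ x y, hatForm (g x) (g y) = hatForm x y) (a : VHat V) :
    hatReflection (g a) = g * hatReflection a * g⁻¹ := by
  ext x : 1
  obtain ⟨y, rfl⟩ := g.surjective x
  have : g⁻¹ (g y) = y := g.symm_apply_apply y
  simp [hatReflection_apply, LinearEquiv.mul_apply, hatCheck, hg, this]

theorem reflection_mem {a : VHat V} (ha : a ∈ D.affineRoots) : hatReflection a ∈ D.affineWeyl :=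
  Subgroup.subset_closure ⟨a, ha, rfl⟩

theorem form_inv_left {g : VHat V ≃ₗ[ℝ] VHat V} (hg : g ∈ D.extWeyl) (x y : VHat V) :
    hatForm (g⁻¹ x) y = hatForm x (g y) := by
  rw [← (D.extWeyl_props hg).1]
  exact congrArg (fun z => hatForm z (g y)) (g.apply_symm_apply x)

theorem inv_mem_affineRoots {g : VHat V ≃ₗ[ℝ] VHat V} (hg : g ∈ D.extWeyl) {a : VHat V}
    (ha : a ∈ D.affineRoots) : g⁻¹ a ∈ D.affineRoots :=
  ((D.extWeyl_props (inv_mem hg)).2.2 a).2 ha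

theorem neg_notMem_posRoots [FiniteDimensional ℝ V] {a : VHat V} (ha : a ∈ D.posRoots) :
    -a ∉ D.posRoots := fun h => by
  obtain ⟨x, hx⟩ := D.fundamental_nonempty
  have h1 := D.form_pos_of_mem_posRoots ha hx
  have h2 := D.form_pos_of_mem_posRoots h hx
  rw [map_neg, LinearMap.neg_apply] at h2
  linarith

/-- A simple reflection `s_a` permutes the positive roots other than `a`. -/
theorem reflection_pos [FiniteDimensional ℝ V] {a γ : VHat V} (ha : a ∈ D.simpleAffineRoots)
    (hγ : γ ∈ D.posRoots) (hne : γ ≠ a) : hatReflection a γ ∈ D.posRoots := by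
  -- Here s_a fixes x, so (s_a γ, x) = (γ, x) ≥ 0. If s_a γ were negative, this number would be 0,
  -- making γ a multiple of a and hence equal to a.
  obtain ⟨x, hx0, hx⟩ := D.exists_face_point {a}
  have h0 := hx0 a ha rfl
  have hr : hatReflection a γ ∈ D.affineRoots :=
    ((D.extWeyl_props (D.reflection_mem_extWeyl (D.simple_subset ha))).2.2 γ).2 hγ.1
  refine (D.pos_or_neg_pos hr).resolve_right fun h => ?_
  have h1 := (hx _ h.2).1
  rw [map_neg, LinearMap.neg_apply, hatForm_hatReflection_left,
    hatReflection_of_form_eq_zero h0] at h1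
  obtain ⟨h2, h3⟩ := hx _ hγ.2
  exact hne (D.eq_of_mem_closure_singleton (D.simple_subset ha) hγ.1 (h3 (by linarith)))

/-! ### Inversion sets -/

/-- The inversion set of `w`: the positive roots `γ` with `w⁻¹ γ` negative. -/
def inversions (w : VHat V ≃ₗ[ℝ] VHat V) : Set (VHat V) :=
  {γ | γ ∈ D.posRoots ∧ -(w⁻¹ γ) ∈ D.posRoots}

theorem inv_pos_of_notMem {w : VHat V ≃ₗ[ℝ] VHat V} (hw : w ∈ D.extWeyl) {γ : VHat V}
    (hγ : γ ∈ D.posRoots) (h : γ ∉ D.inversions w) : w⁻¹ γ ∈ D.posRoots :=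
  (D.pos_or_neg_pos (D.inv_mem_affineRoots hw hγ.1)).resolve_right fun h' => h ⟨hγ, h'⟩

theorem notMem_inversions [FiniteDimensional ℝ V] {w : VHat V ≃ₗ[ℝ] VHat V} {γ : VHat V}
    (h : w⁻¹ γ ∈ D.posRoots) : γ ∉ D.inversions w := fun h' => D.neg_notMem_posRoots h h'.2

theorem inversions_one [FiniteDimensional ℝ V] : D.inversions 1 = ∅ :=
  Set.eq_empty_of_forall_notMem fun _ h => D.neg_notMem_posRoots h.1 h.2

/-- For x in the fundamental chamber, an inversion α + mc is positive at x and negative at w x. Both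
points have the same positive `d`-coordinate, which bounds m on both sides for each of the finitely
many α. -/
theorem inversions_finite [FiniteDimensional ℝ V] [Finite ι] {w : VHat V ≃ₗ[ℝ] VHat V}
    (hw : w ∈ D.extWeyl) : (D.inversions w).Finite := by
  obtain ⟨x, hx⟩ := D.fundamental_nonempty
  have hd : 0 < x.2.2 := (D.fundamental_subset hx).1
  have hd' : (w x).2.2 = x.2.2 := (D.extWeyl_props hw).2.1 x
  have : D.inversions w ⊆ ⋃ i : ι, (fun m : ℤ => D.affineRoot i m) ''
      Set.Icc ⌊-⟪D.α i, x.1⟫_ℝ / x.2.2⌋ ⌈-⟪D.α i, (w x).1⟫_ℝ / x.2.2⌉ := by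
    rintro _ ⟨hγ, hγ'⟩
    obtain ⟨i, m, rfl⟩ := hγ.1
    have h1 := D.form_pos_of_mem_posRoots hγ hx
    have h2 := D.form_pos_of_mem_posRoots hγ' hx
    rw [map_neg, LinearMap.neg_apply, D.form_inv_left hw] at h2
    simp only [hatForm_apply, affineRoot, zero_mul, add_zero, hd'] at h1 h2
    refine Set.mem_iUnion.2 ⟨i, m, ⟨?_, ?_⟩, rfl⟩
    · rw [← Int.cast_le (R := ℝ)]
      refine (Int.floor_le _).trans ?_
      rw [div_le_iff₀ hd]
      linarith
    · rw [← Int.cast_le (R := ℝ)]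
      refine le_trans ?_ (Int.le_ceil _)
      rw [le_div_iff₀ hd]
      linarith
  exact (Set.finite_iUnion fun i => (Set.finite_Icc _ _).image _).subset this

theorem map_mem_closure {g : VHat V ≃ₗ[ℝ] VHat V} {J K : Set (VHat V)}
    (h : ∀ i ∈ J, g i ∈ AddSubmonoid.closure K) {y : VHat V} (hy : y ∈ AddSubmonoid.closure J) :
    g y ∈ AddSubmonoid.closure K := by
  induction hy using AddSubmonoid.closure_induction with
  | mem i hi => exact h i hi
  | zero => simp
  | add y z _ _ hy hz => rw [map_add]; exact add_mem hy hz

/-- If w⁻¹ kept all simple roots positive, it would keep all their sums positive, leaving no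
inversion. -/
theorem exists_simple_mem_inversions [FiniteDimensional ℝ V] {w : VHat V ≃ₗ[ℝ] VHat V}
    (hw : w ∈ D.extWeyl) (h : (D.inversions w).Nonempty) :
    ∃ a ∈ D.simpleAffineRoots, a ∈ D.inversions w := by
  by_contra! hne
  obtain ⟨γ, hγ, hγ'⟩ := h
  have hr := D.inv_mem_affineRoots hw hγ.1
  have : w⁻¹ γ ∈ AddSubmonoid.closure D.simpleAffineRoots :=
    map_mem_closure (fun a ha => (D.inv_pos_of_notMem hw (D.simple_pos ha) (hne a ha)).2) hγ.2
  exact D.neg_notMem_posRoots ⟨hr, this⟩ hγ'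

theorem mul_inv_apply (g h : VHat V ≃ₗ[ℝ] VHat V) (x : VHat V) : (g * h)⁻¹ x = h⁻¹ (g⁻¹ x) := by
  rw [mul_inv_rev]; rfl

theorem reflection_mul_inv_apply (a : VHat V) (h : VHat V ≃ₗ[ℝ] VHat V) (x : VHat V) :
    (hatReflection a * h)⁻¹ x = h⁻¹ (hatReflection a x) := by
  rw [mul_inv_apply, hatReflection_inv]

/-- `γ > 0` is an inversion of `s_γ w` if and only if it is not one of `w`. -/
theorem mem_inversions_reflection_mul [FiniteDimensional ℝ V] {w : VHat V ≃ₗ[ℝ] VHat V}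
    (hw : w ∈ D.extWeyl) {γ : VHat V} (hγ : γ ∈ D.posRoots) :
    γ ∈ D.inversions (hatReflection γ * w) ↔ γ ∉ D.inversions w := by
  have h : -((hatReflection γ * w)⁻¹ γ) = w⁻¹ γ := by
    rw [reflection_mul_inv_apply, hatReflection_self (D.hatForm_self_pos hγ.1).ne', map_neg, neg_neg]
  constructor
  · rintro ⟨-, h'⟩
    rw [h] at h'
    exact D.notMem_inversions h'
  · exact fun h' => ⟨hγ, by rw [h]; exact D.inv_pos_of_notMem hw hγ h'⟩

/-- The inversions of `s_a w` when `a` is a simple root that is not an inversion of `w`. -/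
theorem inversions_simple_mul [FiniteDimensional ℝ V] {w : VHat V ≃ₗ[ℝ] VHat V}
    (hw : w ∈ D.extWeyl) {a : VHat V} (ha : a ∈ D.simpleAffineRoots) (h : a ∉ D.inversions w) :
    D.inversions (hatReflection a * w) = insert a (hatReflection a '' D.inversions w) := by
  ext γ
  constructor
  · rintro ⟨h1, h2⟩
    by_cases hγ : γ = a
    · exact Or.inl hγ
    · refine Or.inr ⟨hatReflection a γ, ⟨D.reflection_pos ha h1 hγ, ?_⟩,
        hatReflection_hatReflection a γ⟩
      rwa [reflection_mul_inv_apply] at h2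
  · rintro (rfl | ⟨δ, hδ, rfl⟩)
    · exact (D.mem_inversions_reflection_mul hw (D.simple_pos ha)).2 h
    · refine ⟨D.reflection_pos ha hδ.1 fun h' => h (h' ▸ hδ), ?_⟩
      rw [reflection_mul_inv_apply, hatReflection_hatReflection]
      exact hδ.2

theorem notMem_image_inversions [FiniteDimensional ℝ V] {w : VHat V ≃ₗ[ℝ] VHat V} {a : VHat V}
    (ha : a ∈ D.simpleAffineRoots) : a ∉ hatReflection a '' D.inversions w := by
  rintro ⟨δ, hδ, h⟩
  have : δ = -a := by
    rw [← hatReflection_hatReflection a δ, h,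
      hatReflection_self (D.hatForm_self_pos (D.simple_subset ha)).ne']
  exact D.neg_notMem_posRoots (D.simple_pos ha) (this ▸ hδ.1)

theorem ncard_inversions_simple_mul [FiniteDimensional ℝ V] [Finite ι] {w : VHat V ≃ₗ[ℝ] VHat V}
    (hw : w ∈ D.extWeyl) {a : VHat V} (ha : a ∈ D.simpleAffineRoots) (h : a ∉ D.inversions w) :
    (D.inversions (hatReflection a * w)).ncard = (D.inversions w).ncard + 1 := by
  rw [D.inversions_simple_mul hw ha h, Set.ncard_insert_of_notMem (D.notMem_image_inversions ha)
    ((D.inversions_finite hw).image _), Set.ncard_image_of_injective _ (hatReflection a).injective]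

theorem ncard_inversions_of_mem [FiniteDimensional ℝ V] [Finite ι] {w : VHat V ≃ₗ[ℝ] VHat V}
    (hw : w ∈ D.extWeyl) {a : VHat V} (ha : a ∈ D.simpleAffineRoots) (h : a ∈ D.inversions w) :
    (D.inversions w).ncard = (D.inversions (hatReflection a * w)).ncard + 1 := by
  have hs := D.reflection_mem_extWeyl (D.simple_subset ha)
  have h' : a ∉ D.inversions (hatReflection a * w) := fun h' =>
    (D.mem_inversions_reflection_mul hw (D.simple_pos ha)).1 h' h
  rw [← D.ncard_inversions_simple_mul (mul_mem hs hw) ha h', ← mul_assoc, hatReflection_mul_self,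
    one_mul]

/-! ### Words in the simple reflections -/

/-- `w` is a product of `n` simple reflections. -/
inductive HasWord : ℕ → (VHat V ≃ₗ[ℝ] VHat V) → Prop
  | one : HasWord 0 1
  | mul {n : ℕ} {v : VHat V ≃ₗ[ℝ] VHat V} {a : VHat V} (ha : a ∈ D.simpleAffineRoots)
      (hv : HasWord n v) : HasWord (n + 1) (hatReflection a * v)

variable {D}

theorem HasWord.mem {n : ℕ} {w : VHat V ≃ₗ[ℝ] VHat V} (h : D.HasWord n w) : w ∈ D.affineWeyl := by
  induction h with
  | one => exact one_mem _
  | mul ha _ ih => exact mul_mem (D.reflection_mem (D.simple_subset ha)) ih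

theorem HasWord.mem_ext {n : ℕ} {w : VHat V ≃ₗ[ℝ] VHat V} (h : D.HasWord n w) : w ∈ D.extWeyl :=
  D.affineWeyl_le h.mem

/-- Deletion: if `γ` is an inversion of a product of `n` simple reflections, then `s_γ w` is a
product of `n - 1` simple reflections. -/
theorem HasWord.deletion [FiniteDimensional ℝ V] {n : ℕ} {w : VHat V ≃ₗ[ℝ] VHat V}
    (h : D.HasWord n w) {γ : VHat V} (hγ : γ ∈ D.inversions w) :
    ∃ m, n = m + 1 ∧ D.HasWord m (hatReflection γ * w) := by
  induction h generalizing γ with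
  | one => simp [D.inversions_one] at hγ
  | @mul n v a ha hv ih =>
    by_cases hne : γ = a
    · subst hne
      exact ⟨n, rfl, by rwa [← mul_assoc, hatReflection_mul_self, one_mul]⟩
    · have h2 := hγ.2
      rw [reflection_mul_inv_apply] at h2
      -- Now s_a γ is an inversion of the shorter product v, so a letter of v can be deleted;
      -- prefixing s_a gives s_a s_{s_a γ} v = s_γ s_a v.
      obtain ⟨m, rfl, hm⟩ := ih (γ := hatReflection a γ) ⟨D.reflection_pos ha hγ.1 hne, h2⟩
      refine ⟨m + 1, rfl, ?_⟩
      have := HasWord.mul ha hm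
      rw [hatReflection_map (hatReflection_form a), hatReflection_inv] at this
      simpa [← mul_assoc, hatReflection_mul_self] using this

/-- Each simple factor on the left changes the number of inversions by one, up or down. -/
theorem HasWord.ncard_le [FiniteDimensional ℝ V] [Finite ι] {n : ℕ} {w : VHat V ≃ₗ[ℝ] VHat V}
    (h : D.HasWord n w) : (D.inversions w).ncard ≤ n := by
  induction h with
  | one => simp [D.inversions_one]
  | @mul n v a ha hv ih =>
    by_cases hav : a ∈ D.inversions v
    · have := D.ncard_inversions_of_mem hv.mem_ext ha hav
      omega
    · rw [D.ncard_inversions_simple_mul hv.mem_ext ha hav]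
      omega

variable (D)

/-- The elements that are products of as many simple reflections as they have inversions are stable
under multiplication by simple reflections. -/
theorem hasWord_simple_mul [FiniteDimensional ℝ V] [Finite ι] {w : VHat V ≃ₗ[ℝ] VHat V}
    (h : D.HasWord (D.inversions w).ncard w) {a : VHat V} (ha : a ∈ D.simpleAffineRoots) :
    D.HasWord (D.inversions (hatReflection a * w)).ncard (hatReflection a * w) := by
  by_cases haw : a ∈ D.inversions w
  · obtain ⟨m, hm, hw⟩ := h.deletion haw
    have := D.ncard_inversions_of_mem h.mem_ext ha haw
    rwa [show (D.inversions (hatReflection a * w)).ncard = m by omega]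
  · rw [D.ncard_inversions_simple_mul h.mem_ext ha haw]
    exact HasWord.mul ha h

/-- Every positive root is conjugate to a simple root by a product of simple reflections. -/
theorem exists_simple_conj [FiniteDimensional ℝ V] {γ : VHat V} (hγ : γ ∈ D.posRoots) :
    ∃ (n : ℕ) (v : VHat V ≃ₗ[ℝ] VHat V) (a : VHat V), D.HasWord n v ∧ a ∈ D.simpleAffineRoots ∧
      γ = v a := by
  -- Pairing with ρ is the height, a natural number on sums of simple roots; the induction runs on
  -- the height of γ.
  obtain ⟨ρ, hρ⟩ := D.exists_form_eq fun _ => 1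
  have hnat : ∀ y ∈ AddSubmonoid.closure D.simpleAffineRoots, ∃ n : ℕ, hatForm y ρ = n := by
    intro y hy
    induction hy using AddSubmonoid.closure_induction with
    | mem a ha => exact ⟨1, by simp [hρ a ha]⟩
    | zero => exact ⟨0, by simp⟩
    | add a b _ _ ha hb =>
      obtain ⟨m, hm⟩ := ha
      obtain ⟨n, hn⟩ := hb
      exact ⟨m + n, by simp [hm, hn]⟩
  obtain ⟨n, hn⟩ := hnat γ hγ.2
  induction n using Nat.strong_induction_on generalizing γ with
  | _ n ih =>
    by_cases hs : γ ∈ D.simpleAffineRoots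
    · exact ⟨0, 1, γ, HasWord.one, hs, rfl⟩
    -- Since (γ, γ) > 0 and γ is a sum of simple roots, one of them pairs positively with γ, and its
    -- reflection lowers the height.
    obtain ⟨a, ha, hpos⟩ : ∃ a ∈ D.simpleAffineRoots, 0 < hatForm a γ := by
      by_contra! hne
      have : ∀ y ∈ AddSubmonoid.closure D.simpleAffineRoots, hatForm y γ ≤ 0 := by
        intro y hy
        induction hy using AddSubmonoid.closure_induction with
        | mem a ha => exact hne a ha
        | zero => simp
        | add a b _ _ ha hb => simpa using add_nonpos ha hb
      exact (this γ hγ.2).not_gt (D.hatForm_self_pos hγ.1)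
    have hγ' := D.reflection_pos ha hγ fun h => hs (h ▸ ha)
    obtain ⟨m, hm⟩ := hnat _ hγ'.2
    have hlt : m < n := by
      rw [← Nat.cast_lt (α := ℝ), ← hm, ← hn, hatReflection_apply]
      have : 0 < hatForm γ (hatCheck a) := by
        rw [hatCheck, map_smul, smul_eq_mul, hatForm_comm γ]
        exact mul_pos (div_pos two_pos (D.hatForm_self_pos (D.simple_subset ha))) hpos
      simpa [hρ a ha] using this
    obtain ⟨l, v, b, hv, hb, h⟩ := ih m hlt hγ' hm
    refine ⟨l + 1, _, b, HasWord.mul ha hv, hb, ?_⟩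
    rw [LinearEquiv.mul_apply, ← h, hatReflection_hatReflection]

/-- The affine Weyl group is generated by the simple reflections, and the number of inversions is
the length. -/
theorem hasWord_of_mem [FiniteDimensional ℝ V] [Finite ι] {w : VHat V ≃ₗ[ℝ] VHat V}
    (hw : w ∈ D.affineWeyl) : D.HasWord (D.inversions w).ncard w := by
  let S := Subgroup.closure {g : VHat V ≃ₗ[ℝ] VHat V |
    ∃ a ∈ D.simpleAffineRoots, g = hatReflection a}
  have hS : ∀ {n v}, D.HasWord n v → v ∈ S := by
    intro n v h
    induction h with
    | one => exact one_mem _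
    | mul ha _ ih => exact mul_mem (Subgroup.subset_closure ⟨_, ha, rfl⟩) ih
  have hle : D.affineWeyl ≤ S := by
    rw [affineWeyl, Subgroup.closure_le]
    have key : ∀ γ ∈ D.posRoots, hatReflection γ ∈ S := by
      intro γ hγ
      obtain ⟨n, v, a, hv, ha, rfl⟩ := D.exists_simple_conj hγ
      rw [hatReflection_map (D.extWeyl_props hv.mem_ext).1]
      exact mul_mem (mul_mem (hS hv) (Subgroup.subset_closure ⟨_, ha, rfl⟩)) (inv_mem (hS hv))
    rintro _ ⟨γ, hγ, rfl⟩
    rcases D.pos_or_neg_pos hγ with h | h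
    · exact key γ h
    · rw [← hatReflection_neg]
      exact key _ h
  have hw' := hle hw
  refine Subgroup.closure_induction_left (p := fun w _ => D.HasWord (D.inversions w).ncard w)
    ?_ ?_ ?_ hw'
  · simpa [D.inversions_one] using HasWord.one
  · rintro _ ⟨a, ha, rfl⟩ v _ hv
    exact D.hasWord_simple_mul hv ha
  · rintro _ ⟨a, ha, rfl⟩ v _ hv
    rw [hatReflection_inv]
    exact D.hasWord_simple_mul hv ha

/-- The word given by `hasWord_of_mem` has length zero. This is what makes the action of Ŵ on
chambers free. -/
theorem eq_one_of_inversions_eq_empty [FiniteDimensional ℝ V] [Finite ι]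
    {w : VHat V ≃ₗ[ℝ] VHat V} (hw : w ∈ D.affineWeyl) (h : D.inversions w = ∅) : w = 1 := by
  have := D.hasWord_of_mem hw
  rw [h, Set.ncard_empty] at this
  cases this
  rfl

/-- Deletion shortens a word whose length equals the number of inversions, and no word is shorter
than the number of inversions of its product. This makes the correction terms of the cross relation
accessible to induction on the length. -/
theorem ncard_inversions_reflection_lt [FiniteDimensional ℝ V] [Finite ι]
    {w : VHat V ≃ₗ[ℝ] VHat V} (hw : w ∈ D.affineWeyl) {γ : VHat V} (hγ : γ ∈ D.inversions w) :
    (D.inversions (hatReflection γ * w)).ncard < (D.inversions w).ncard := by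
  obtain ⟨m, hm, h⟩ := (D.hasWord_of_mem hw).deletion hγ
  have := h.ncard_le
  omega

/-- Induction along the simple reflections. -/
theorem affineWeyl_induction [FiniteDimensional ℝ V] [Finite ι]
    {p : D.affineWeyl → Prop} (one : p 1)
    (mul : ∀ (a : D.affineRoots) (v : D.affineWeyl), (a : VHat V) ∈ D.simpleAffineRoots →
      p v → p (D.s a * v)) (w : D.affineWeyl) : p w := by
  have key : ∀ n v, D.HasWord n v → ∀ hv : v ∈ D.affineWeyl, p ⟨v, hv⟩ := by
    intro n v h
    induction h with
    | one => exact fun _ => one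
    | mul ha hv ih => exact fun _ => mul ⟨_, D.simple_subset ha⟩ ⟨_, hv.mem⟩ ha (ih hv.mem)
  exact key _ _ (D.hasWord_of_mem w.2) w.2

/-! ### Chambers and the extended group -/

/-- Every `w ∈ Ŵ^Y` is a product `v ω`, `v ∈ Ŵ`, where `ω` has no inversions. -/
theorem exists_mul_inversions_eq_empty [FiniteDimensional ℝ V] [Finite ι]
    {w : VHat V ≃ₗ[ℝ] VHat V} (hw : w ∈ D.extWeyl) :
    ∃ v ∈ D.affineWeyl, D.inversions (v⁻¹ * w) = ∅ := by
  induction hn : (D.inversions w).ncard generalizing w with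
  | zero =>
    refine ⟨1, one_mem _, ?_⟩
    simpa using (Set.ncard_eq_zero (D.inversions_finite hw)).1 hn
  | succ n ih =>
    obtain ⟨a, ha, haw⟩ := D.exists_simple_mem_inversions hw
      ((Set.ncard_pos (D.inversions_finite hw)).1 (by omega))
    have h := D.ncard_inversions_of_mem hw ha haw
    have hs := D.reflection_mem (D.simple_subset ha)
    obtain ⟨v, hv, h'⟩ := ih (mul_mem (D.affineWeyl_le hs) hw) (by omega)
    refine ⟨hatReflection a * v, mul_mem hs hv, ?_⟩
    rwa [mul_inv_rev, mul_assoc, hatReflection_inv]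

theorem fundamental_subset_preimage {w : VHat V ≃ₗ[ℝ] VHat V} (hw : w ∈ D.extWeyl)
    (h : D.inversions w = ∅) : D.fundamental ⊆ w ⁻¹' D.fundamental := by
  intro x hx a ha
  have hn : a ∉ D.inversions w := by simp [h]
  rw [← D.form_inv_left hw]
  exact D.form_pos_of_mem_posRoots (D.inv_pos_of_notMem hw (D.simple_pos ha) hn) hx

/-- An inversion γ would be positive at w x, yet (γ, w x) = (w⁻¹ γ, x) < 0. -/
theorem inversions_eq_empty_of_exists [FiniteDimensional ℝ V] {w : VHat V ≃ₗ[ℝ] VHat V}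
    (hw : w ∈ D.extWeyl) {x : VHat V} (hx : x ∈ D.fundamental) (hwx : w x ∈ D.fundamental) :
    D.inversions w = ∅ := by
  refine Set.eq_empty_of_forall_notMem fun γ hγ => ?_
  have h1 := D.form_pos_of_mem_posRoots hγ.1 hwx
  have h2 := D.form_pos_of_mem_posRoots hγ.2 hx
  rw [map_neg, LinearMap.neg_apply, D.form_inv_left hw] at h2
  linarith

theorem inversions_inv_eq_empty [FiniteDimensional ℝ V] {w : VHat V ≃ₗ[ℝ] VHat V}
    (hw : w ∈ D.extWeyl) (h : D.inversions w = ∅) : D.inversions w⁻¹ = ∅ := by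
  obtain ⟨x, hx⟩ := D.fundamental_nonempty
  refine D.inversions_eq_empty_of_exists (inv_mem hw)
    (D.fundamental_subset_preimage hw h hx) ?_
  rwa [show w⁻¹ (w x) = x from w.symm_apply_apply x]

theorem image_fundamental_eq [FiniteDimensional ℝ V] {w : VHat V ≃ₗ[ℝ] VHat V}
    (hw : w ∈ D.extWeyl) (h : D.inversions w = ∅) : w '' D.fundamental = D.fundamental := by
  refine Set.Subset.antisymm
    (Set.image_subset_iff.2 (D.fundamental_subset_preimage hw h)) fun x hx => ?_
  exact ⟨w⁻¹ x, D.fundamental_subset_preimage (inv_mem hw)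
    (D.inversions_inv_eq_empty hw h) hx, w.apply_symm_apply x⟩

theorem inversions_eq_empty_of_image_eq [FiniteDimensional ℝ V] {v w : VHat V ≃ₗ[ℝ] VHat V}
    (hv : v ∈ D.extWeyl) (hw : w ∈ D.extWeyl) (h : v '' D.fundamental = w '' D.fundamental) :
    D.inversions (v⁻¹ * w) = ∅ := by
  obtain ⟨x, hx⟩ := D.fundamental_nonempty
  obtain ⟨y, hy, hxy⟩ : w x ∈ v '' D.fundamental := h ▸ Set.mem_image_of_mem w hx
  refine D.inversions_eq_empty_of_exists (mul_mem (inv_mem hv) hw) hx ?_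
  rw [LinearEquiv.mul_apply, ← hxy]
  rwa [show v⁻¹ (v y) = y from v.symm_apply_apply y]

/-- An element of `Ŵ^Y` without inversions permutes the simple affine roots. -/
theorem map_simple_of_inversions_eq_empty [FiniteDimensional ℝ V]
    {w : VHat V ≃ₗ[ℝ] VHat V} (hw : w ∈ D.extWeyl) (h : D.inversions w = ∅) {a : VHat V}
    (ha : a ∈ D.simpleAffineRoots) : w a ∈ D.simpleAffineRoots := by
  have hpos : ∀ {w : VHat V ≃ₗ[ℝ] VHat V}, w ∈ D.extWeyl → D.inversions w = ∅ →
      ∀ γ ∈ D.posRoots, w⁻¹ γ ∈ D.posRoots := fun hw h γ hγ =>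
    D.inv_pos_of_notMem hw hγ (by simp [h])
  have hpos' : ∀ γ ∈ D.posRoots, w γ ∈ D.posRoots := by
    simpa using hpos (inv_mem hw) (D.inversions_inv_eq_empty hw h)
  have hwa := hpos' a (D.simple_pos ha)
  -- The reflection s_{wa} inverts w a, hence also some simple root b. If w⁻¹ b ≠ a, then s_a w⁻¹ b
  -- is positive, and so is w s_a w⁻¹ b = s_{wa} b, a contradiction. Hence b = w a.
  obtain ⟨b, hb, hb'⟩ := D.exists_simple_mem_inversions (D.reflection_mem_extWeyl hwa.1)
    ⟨w a, hwa, by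
      rw [hatReflection_inv, hatReflection_self (D.hatForm_self_pos hwa.1).ne', neg_neg]
      exact hwa⟩
  suffices w⁻¹ b = a by
    rw [← this, show w (w⁻¹ b) = b from w.apply_symm_apply b]
    exact hb
  by_contra hne
  have h1 := hpos' _ (D.reflection_pos ha (hpos hw h b hb'.1) hne)
  have h2 := hb'.2
  rw [hatReflection_inv, hatReflection_map (D.extWeyl_props hw).1] at h2
  exact D.neg_notMem_posRoots h1 h2

/-! ### Rank two parabolic subgroups -/

/-- Uniqueness of the shortest element of the coset of the subgroup generated by `s_a`, `s_b`. -/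
theorem eq_one_of_minimal [FiniteDimensional ℝ V] [Finite ι] {a b : VHat V}
    (ha : a ∈ D.simpleAffineRoots) (hb : b ∈ D.simpleAffineRoots) {g v : VHat V ≃ₗ[ℝ] VHat V}
    (hg : g ∈ Subgroup.closure {hatReflection a, hatReflection b}) (hv : v ∈ D.affineWeyl)
    (h1 : ∀ i ∈ ({a, b} : Set (VHat V)), i ∉ D.inversions v)
    (h2 : ∀ i ∈ ({a, b} : Set (VHat V)), i ∉ D.inversions (g * v)) : g = 1 := by
  obtain ⟨x, hx0, hx⟩ := D.exists_face_point {a, b}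
  have hJ : ∀ i ∈ ({a, b} : Set (VHat V)), i ∈ D.simpleAffineRoots := by
    rintro i (rfl | rfl) <;> assumption
  have hgW : g ∈ D.affineWeyl := by
    refine (Subgroup.closure_le _).2 ?_ hg
    rintro _ (rfl | rfl)
    · exact D.reflection_mem (D.simple_subset ha)
    · exact D.reflection_mem (D.simple_subset hb)
  have hgE := D.affineWeyl_le hgW
  -- Since g fixes x, it preserves the pairing with x; a positive root pairs to zero with x only if
  -- it is a sum of copies of a and b.
  have hgx : g x = x := by
    have : Subgroup.closure {hatReflection a, hatReflection b} ≤
        MulAction.stabilizer (VHat V ≃ₗ[ℝ] VHat V) x := by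
      rw [Subgroup.closure_le]
      rintro _ (rfl | rfl)
      · exact hatReflection_of_form_eq_zero (hx0 a ha (by simp))
      · exact hatReflection_of_form_eq_zero (hx0 b hb (by simp))
    exact this hg
  have hform : ∀ γ, hatForm (g⁻¹ γ) x = hatForm γ x := fun γ => by
    rw [D.form_inv_left hgE, hgx]
  by_contra hne
  -- Every inversion of g pairs to zero with x, so it is a sum of copies of a and b; if neither were
  -- an inversion, g would have none and be trivial.
  obtain ⟨i, hi, hig⟩ : ∃ i ∈ ({a, b} : Set (VHat V)), i ∈ D.inversions g := by
    by_contra! hn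
    refine hne (D.eq_one_of_inversions_eq_empty hgW (Set.eq_empty_of_forall_notMem ?_))
    rintro γ ⟨hγ, hγ'⟩
    have h3 := (hx _ hγ'.2).1
    rw [map_neg, LinearMap.neg_apply, hform] at h3
    obtain ⟨h4, h5⟩ := hx _ hγ.2
    have h6 : g⁻¹ γ ∈ AddSubmonoid.closure D.simpleAffineRoots :=
      map_mem_closure (fun i hi => (D.inv_pos_of_notMem hgE (D.simple_pos (hJ i hi)) (hn i hi)).2)
        (h5 (by linarith))
    exact D.neg_notMem_posRoots ⟨D.inv_mem_affineRoots hgE hγ.1, h6⟩ hγ'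
  have hvE := D.affineWeyl_le hv
  -- Thus -g⁻¹ i is a sum of copies of a and b, which v⁻¹ keeps positive; this makes i an inversion
  -- of g v, against the minimality of g v.
  have h3 := (hx _ hig.2.2).2 (by
    rw [map_neg, LinearMap.neg_apply, hform, hx0 i (hJ i hi) hi, neg_zero])
  have h4 : v⁻¹ (-(g⁻¹ i)) ∈ AddSubmonoid.closure D.simpleAffineRoots :=
    map_mem_closure (fun i hi => (D.inv_pos_of_notMem hvE (D.simple_pos (hJ i hi)) (h1 i hi)).2) h3
  refine h2 i hi ⟨hig.1, ?_⟩
  rw [mul_inv_apply, ← map_neg]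
  exact ⟨D.inv_mem_affineRoots hvE hig.2.1, h4⟩

theorem hatForm_nullRoot (x : VHat V) : hatForm ((0 : V), (1 : ℝ), (0 : ℝ)) x = x.2.2 := by
  simp [hatForm_apply]

/-- Simple roots that are inversions of a common element do not have the null root in their span. -/
theorem nullRoot_notMem_closure [FiniteDimensional ℝ V] {w : VHat V ≃ₗ[ℝ] VHat V}
    (hw : w ∈ D.extWeyl) {J : Set (VHat V)} (hJ : J ⊆ D.inversions w) :
    ((0 : V), (1 : ℝ), (0 : ℝ)) ∉ AddSubmonoid.closure J := by
  intro h
  obtain ⟨x, hx⟩ := D.fundamental_nonempty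
  -- For y = c this contradicts (w⁻¹ c, x) = (c, w x), the `d`-coordinate of w x, which equals that
  -- of x and is positive.
  have key : ∀ y ∈ AddSubmonoid.closure J, 0 ≤ hatForm (-(w⁻¹ y)) x := by
    intro y hy
    induction hy using AddSubmonoid.closure_induction with
    | mem i hi => exact (D.form_pos_of_mem_posRoots (hJ hi).2 hx).le
    | zero => simp
    | add y z _ _ hy hz =>
      simp only [map_neg, map_add, LinearMap.neg_apply, LinearMap.add_apply] at *
      linarith
  have h1 := key _ h
  rw [map_neg, LinearMap.neg_apply, D.form_inv_left hw, hatForm_nullRoot,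
    (D.extWeyl_props hw).2.1] at h1
  have : 0 < x.2.2 := (D.fundamental_subset hx).1
  linarith

end Combinatorics

end AffineRootDatum

/-! ### Analyticity of integrals along a line -/

section LineIntegral

variable {E F : Type*} [NormedAddCommGroup E] [NormedSpace ℝ E] [NormedAddCommGroup F]
  [NormedSpace ℝ F] {U : Set E} {f : E → F} {v : E}

theorem continuous_compContinuousLinearMap {n : ℕ} (q : ContinuousMultilinearMap ℝ (fun _ : Fin n => E) F)
    {A : ℝ → E →L[ℝ] E} (hA : Continuous A) :
    Continuous fun σ => q.compContinuousLinearMap fun _ => A σ := by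
  have h1 := (ContinuousMultilinearMap.compContinuousLinearMapContinuousMultilinear ℝ
    (fun _ : Fin n => E) (fun _ : Fin n => E) F).cont
  have h2 : Continuous fun σ (_ : Fin n) => A σ := continuous_pi fun _ => hA
  exact (h1.comp h2).clm_apply continuous_const

/-- `(s, x) ↦ ∫_0^s f(x - t v) dt`. -/
noncomputable def lineIntegral (f : E → F) (v : E) (z : ℝ × E) : F :=
  ∫ t in (0 : ℝ)..z.1, f (z.2 - t • v)

theorem continuous_line (hf : AnalyticOnNhd ℝ f U) (hUv : ∀ x ∈ U, ∀ t : ℝ, x - t • v ∈ U) {x : E}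
    (hx : x ∈ U) : Continuous fun t : ℝ => f (x - t • v) :=
  continuous_iff_continuousAt.2 fun t =>
    ContinuousAt.comp' (hf _ (hUv x hx t)).continuousAt (by fun_prop)

theorem lineIntegral_add (hf : AnalyticOnNhd ℝ f U) (hUv : ∀ x ∈ U, ∀ t : ℝ, x - t • v ∈ U)
    {x : E} (hx : x ∈ U) (s t : ℝ) :
    lineIntegral f v (t, x) = lineIntegral f v (s, x) + lineIntegral f v (t - s, x - s • v) := by
  have hc := continuous_line hf hUv hx
  have h := intervalIntegral.integral_comp_add_right (a := 0) (b := t - s)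
    (fun t => f (x - t • v)) s
  rw [zero_add, sub_add_cancel] at h
  simp only [lineIntegral]
  rw [← intervalIntegral.integral_add_adjacent_intervals (hc.intervalIntegrable 0 s)
    (hc.intervalIntegrable s t), ← h]
  congr 2
  funext r
  congr 1
  module

/-- Symmetry of the second derivative allows the fixed direction e, in which the first derivative is
known near z, to be differentiated first. -/
theorem fderiv_fderiv_apply_eq {G g : E → F} {z : E} (hG : ContDiffAt ℝ 2 G z) {e : E}
    (h : ∀ᶠ y in 𝓝 z, fderiv ℝ G y e = g y) {g' : E →L[ℝ] F} (hg : HasFDerivAt g g' z) (u : E) :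
    fderiv ℝ (fderiv ℝ G) z e u = g' u := by
  have h1 : HasFDerivAt (fderiv ℝ G) (fderiv ℝ (fderiv ℝ G) z) z :=
    ((hG.fderiv_right (m := 1) (by norm_num)).differentiableAt one_ne_zero).hasFDerivAt
  have hsymm : IsSymmSndFDerivAt ℝ G z := hG.isSymmSndFDerivAt (by simp)
  have h4 := h1.clm_apply (hasFDerivAt_const e z)
  have h7 := h4.unique (hg.congr_of_eventuallyEq h)
  have h8 := congrArg (fun L => L u) h7
  rw [hsymm e u, ← h8]
  simp

theorem hasDerivAt_fderiv_snd {G g : ℝ × E → F} {s : ℝ} {x : E}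
    (hG : ContDiffAt ℝ 2 G (s, x)) (h : ∀ᶠ z in 𝓝 (s, x), fderiv ℝ G z (1, 0) = g z)
    {g' : ℝ × E →L[ℝ] F} (hg : HasFDerivAt g g' (s, x)) (u : E) :
    HasDerivAt (fun t => fderiv ℝ G (t, x) (0, u)) (g' (0, u)) s := by
  have h1 : HasFDerivAt (fderiv ℝ G) (fderiv ℝ (fderiv ℝ G) (s, x)) (s, x) :=
    ((hG.fderiv_right (m := 1) (by norm_num)).differentiableAt one_ne_zero).hasFDerivAt
  have h2 : HasDerivAt (fun t : ℝ => (t, x)) ((1 : ℝ), (0 : E)) s :=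
    (hasDerivAt_id s).prodMk (hasDerivAt_const s x)
  have h3 : HasDerivAt (fun t : ℝ => fderiv ℝ G (t, x))
    (fderiv ℝ (fderiv ℝ G) (s, x) (1, 0)) s := HasFDerivAt.comp_hasDerivAt s h1 h2
  rw [← fderiv_fderiv_apply_eq hG h hg]
  exact ((ContinuousLinearMap.apply ℝ F ((0 : ℝ), u)).hasFDerivAt.comp_hasDerivAt s h3)

variable [CompleteSpace F]

theorem integral_compContinuousLinearMap_apply {n : ℕ}
    (q : ContinuousMultilinearMap ℝ (fun _ : Fin n => E) F) {A : ℝ → E →L[ℝ] E} (hA : Continuous A)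
    (y : E) : (∫ σ in (0 : ℝ)..1, q.compContinuousLinearMap fun _ => A σ) (fun _ => y) =
      ∫ σ in (0 : ℝ)..1, q fun _ => A σ y := by
  have h1 := (continuous_compContinuousLinearMap q hA).intervalIntegrable
    (μ := MeasureTheory.volume) 0 1
  have h2 := ContinuousLinearMap.intervalIntegral_comp_comm
    (ContinuousMultilinearMap.apply ℝ (fun _ : Fin n => E) F fun _ => y) h1
  exact h2.symm

/-- Composing a homogeneous term with contractions does not increase its norm, so the series may be
integrated term by term on the same ball, dominated by the terms ‖p n‖ ‖y‖ ^ n. -/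
theorem HasFPowerSeriesOnBall.integral_comp_contraction {h : E → F}
    {p : FormalMultilinearSeries ℝ E F} {z : E} {r : ENNReal} (hp : HasFPowerSeriesOnBall h p z r)
    {A : ℝ → E →L[ℝ] E} (hA : Continuous A) (hnorm : ∀ σ ∈ Set.uIoc (0 : ℝ) 1, ‖A σ‖ ≤ 1) :
    HasFPowerSeriesOnBall (fun w => ∫ σ in (0 : ℝ)..1, h (z + A σ (w - z)))
      (fun n => ∫ σ in (0 : ℝ)..1, (p n).compContinuousLinearMap fun _ => A σ) z r := by
  have hcont := fun n => continuous_compContinuousLinearMap (p n) hA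
  have hle : ∀ n, ∀ σ ∈ Set.uIoc (0 : ℝ) 1,
      ‖(p n).compContinuousLinearMap fun _ => A σ‖ ≤ ‖p n‖ := fun n σ hσ => by
    refine ((p n).norm_compContinuousLinearMap_le _).trans ?_
    refine mul_le_of_le_one_right (norm_nonneg _) ?_
    exact Finset.prod_le_one (fun _ _ => norm_nonneg _) fun _ _ => hnorm σ hσ
  refine ⟨hp.r_le.trans (FormalMultilinearSeries.radius_le_of_le fun n => ?_), hp.r_pos,
    fun {y} hy => ?_⟩
  · simpa using intervalIntegral.norm_integral_le_of_norm_le_const (hle n)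
  · have heval := fun n => integral_compContinuousLinearMap_apply (p n) hA y
    simp only [heval, add_sub_cancel_left]
    have hy' : (‖y‖₊ : ENNReal) < p.radius := by
      refine lt_of_lt_of_le ?_ hp.r_le
      simpa [Metric.mem_eball, edist_zero_right, enorm_eq_nnnorm] using hy
    have hAy : ∀ σ ∈ Set.uIoc (0 : ℝ) 1, ‖A σ y‖ ≤ ‖y‖ := fun σ hσ =>
      ((A σ).le_opNorm y).trans (mul_le_of_le_one_left (norm_nonneg _) (hnorm σ hσ))
    have hsum : Summable fun n => ‖p n‖ * ‖y‖ ^ n := by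
      simpa only [coe_nnnorm] using p.summable_norm_mul_pow hy'
    refine intervalIntegral.hasSum_integral_of_dominated_convergence
      (fun n _ => ‖p n‖ * ‖y‖ ^ n) (fun n => ?_) (fun n => ?_) ?_ ?_ ?_
    · refine Continuous.aestronglyMeasurable ?_
      exact (p n).cont.comp (continuous_pi fun _ => hA.clm_apply continuous_const)
    · refine Filter.Eventually.of_forall fun σ hσ => ((p n).le_opNorm _).trans ?_
      simp only [Finset.prod_const, Finset.card_univ, Fintype.card_fin]
      gcongr
      exact hAy σ hσ
    · exact Filter.Eventually.of_forall fun _ _ => hsum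
    · exact intervalIntegrable_const
    · refine Filter.Eventually.of_forall fun σ hσ => hp.hasSum ?_
      rw [Metric.mem_eball, edist_zero_right] at hy ⊢
      refine lt_of_le_of_lt ?_ hy
      rw [enorm_le_iff_norm_le]
      exact hAy σ hσ

/-- The substitution t = σ s turns the integral into s ∫_0^1 f(y - σ s v) dσ. The maps (s, y) ↦ (σ
s, y) are contractions fixing the centre (0, x), so a power series of f(y - s v) at that centre can
be integrated over σ. -/
theorem analyticAt_lineIntegral_zero {x : E} (hf : AnalyticAt ℝ f x) :
    AnalyticAt ℝ (lineIntegral f v) (0, x) := by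
  have h1 : AnalyticAt ℝ (fun z : ℝ × E => f (z.2 - z.1 • v)) (0, x) := by
    refine AnalyticAt.fun_comp (g := f) ?_ ?_
    · simpa using hf
    · exact analyticAt_snd.sub (analyticAt_fst.smul analyticAt_const)
  obtain ⟨p, r, hp⟩ := h1
  let A : ℝ → ℝ × E →L[ℝ] ℝ × E := fun σ =>
    (σ • ContinuousLinearMap.fst ℝ ℝ E).prod (ContinuousLinearMap.snd ℝ ℝ E)
  have hA : Continuous A := by
    have : A = fun σ => σ • (ContinuousLinearMap.fst ℝ ℝ E).prod (0 : ℝ × E →L[ℝ] E) +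
        (0 : ℝ × E →L[ℝ] ℝ).prod (ContinuousLinearMap.snd ℝ ℝ E) := by
      funext σ
      ext z <;> simp [A]
    rw [this]
    fun_prop
  have hn : ∀ σ ∈ Set.uIoc (0 : ℝ) 1, ‖A σ‖ ≤ 1 := by
    intro σ hσ
    rw [Set.uIoc_of_le zero_le_one] at hσ
    refine ContinuousLinearMap.opNorm_le_bound _ zero_le_one fun z => ?_
    rw [one_mul, Prod.norm_def, Prod.norm_def]
    refine max_le_max ?_ le_rfl
    simp only [A, ContinuousLinearMap.prod_apply, smul_apply,
      ContinuousLinearMap.coe_fst', norm_smul, Real.norm_eq_abs, abs_of_pos hσ.1]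
    exact mul_le_of_le_one_left (abs_nonneg _) hσ.2
  have h2 := (hp.integral_comp_contraction hA hn).analyticAt
  refine (analyticAt_fst.smul h2).congr (Filter.Eventually.of_forall fun z => ?_)
  have h3 := intervalIntegral.smul_integral_comp_mul_left (a := 0) (b := 1)
    (fun t => f (z.2 - t • v)) z.1
  simp only [mul_zero, mul_one] at h3
  simp only [lineIntegral, ← h3]
  refine congrArg (fun y : F => z.1 • y) ?_
  refine intervalIntegral.integral_congr fun σ _ => ?_
  simp [A, mul_comm]

/-- The case of upper limit 0, moved along the line to s; nearby limits t come free because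
analyticity is an open condition. -/
theorem analyticAt_lineIntegral_shift (hf : AnalyticOnNhd ℝ f U)
    (hUv : ∀ x ∈ U, ∀ t : ℝ, x - t • v ∈ U) {x : E} (hx : x ∈ U) (s : ℝ) :
    ∀ᶠ t in 𝓝 s, AnalyticAt ℝ (fun z : ℝ × E => lineIntegral f v (z.1 - s, z.2 - s • v)) (t, x) := by
  have h1 := analyticAt_lineIntegral_zero (v := v) (hf _ (hUv x hx s))
  have h2 : AnalyticAt ℝ (fun z : ℝ × E => lineIntegral f v (z.1 - s, z.2 - s • v)) (s, x) := by
    refine AnalyticAt.fun_comp (g := lineIntegral f v) (f := fun z : ℝ × E => (z.1 - s, z.2 - s • v))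
      ?_ ?_
    · simpa using h1
    · exact (analyticAt_fst.sub analyticAt_const).prod (analyticAt_snd.sub analyticAt_const)
  have h3 := h2.eventually_analyticAt
  have h4 : Filter.Tendsto (fun t : ℝ => (t, x)) (𝓝 s) (𝓝 (s, x)) :=
    Continuous.tendsto (by fun_prop) s
  exact h4.eventually h3

/-- The integral of an analytic function along a line is analytic in the end point and in the
line. -/
theorem analyticAt_lineIntegral (hU : IsOpen U) (hf : AnalyticOnNhd ℝ f U)
    (hUv : ∀ x ∈ U, ∀ t : ℝ, x - t • v ∈ U) {x : E} (hx : x ∈ U) (s : ℝ) :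
    AnalyticAt ℝ (lineIntegral f v) (s, x) := by
  have hpair : ∀ t : ℝ, AnalyticAt ℝ (fun y : E => (t, y)) x := fun t =>
    analyticAt_const.prod analyticAt_id
  -- Additivity of the integral makes membership in S locally constant, so S is clopen; it contains
  -- 0, hence is all of ℝ.
  let S : Set ℝ := {s | AnalyticAt ℝ (fun y => lineIntegral f v (s, y)) x}
  have hS : ∀ s, ∀ᶠ t in 𝓝 s, (t ∈ S ↔ s ∈ S) := by
    intro s
    filter_upwards [analyticAt_lineIntegral_shift hf hUv hx s] with t ht
    have h1 : AnalyticAt ℝ (fun y => lineIntegral f v (t - s, y - s • v)) x := ht.fun_comp (hpair t)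
    have h2 : (fun y => lineIntegral f v (t, y)) =ᶠ[𝓝 x] fun y =>
        lineIntegral f v (s, y) + lineIntegral f v (t - s, y - s • v) := by
      filter_upwards [hU.mem_nhds hx] with y hy
      exact lineIntegral_add hf hUv hy s t
    constructor
    · intro h
      refine (AnalyticAt.sub (show AnalyticAt ℝ _ x from h) h1).congr ?_
      filter_upwards [h2] with y hy
      simp [hy]
    · exact fun h => ((show AnalyticAt ℝ _ x from h).add h1).congr h2.symm
  have huniv : S = Set.univ := by
    refine IsClopen.eq_univ ⟨⟨?_⟩, ?_⟩ ⟨0, ?_⟩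
    · rw [isOpen_iff_mem_nhds]
      intro s hs
      filter_upwards [hS s] with t ht
      exact fun h => hs (ht.1 h)
    · rw [isOpen_iff_mem_nhds]
      intro s hs
      filter_upwards [hS s] with t ht
      exact ht.2 hs
    · refine (analyticAt_const (v := (0 : F))).congr (Filter.Eventually.of_forall fun y => ?_)
      simp [lineIntegral]
  have hs : AnalyticAt ℝ (fun y => lineIntegral f v (s, y)) x :=
    (huniv ▸ Set.mem_univ s : s ∈ S)
  have h1 : AnalyticAt ℝ (fun z : ℝ × E => lineIntegral f v (s, z.2)) (s, x) :=
    AnalyticAt.fun_comp (g := fun y => lineIntegral f v (s, y)) (f := Prod.snd) hs analyticAt_snd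
  have h2 := (analyticAt_lineIntegral_shift hf hUv hx s).self_of_nhds
  refine (h1.add h2).congr ?_
  have h3 : ∀ᶠ z : ℝ × E in 𝓝 (s, x), z.2 ∈ U :=
    continuous_snd.continuousAt.eventually (hU.mem_nhds hx)
  filter_upwards [h3] with z hz
  exact (lineIntegral_add hf hUv hz s z.1).symm

theorem fderiv_lineIntegral_fst (hU : IsOpen U) (hf : AnalyticOnNhd ℝ f U)
    (hUv : ∀ x ∈ U, ∀ t : ℝ, x - t • v ∈ U) {x : E} (hx : x ∈ U) (s : ℝ) :
    fderiv ℝ (lineIntegral f v) (s, x) (1, 0) = f (x - s • v) := by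
  have h1 := (analyticAt_lineIntegral hU hf hUv hx s).differentiableAt.hasFDerivAt
  have h2 : HasDerivAt (fun t : ℝ => (t, x)) ((1 : ℝ), (0 : E)) s :=
    (hasDerivAt_id s).prodMk (hasDerivAt_const s x)
  have h3 := h1.comp_hasDerivAt s h2
  have hc := continuous_line hf hUv hx
  have h4 := intervalIntegral.integral_hasDerivAt_right (hc.intervalIntegrable 0 s)
    hc.stronglyMeasurable.stronglyMeasurableAtFilter hc.continuousAt
  exact h3.unique h4

theorem hasDerivAt_fderiv_lineIntegral (hU : IsOpen U) (hf : AnalyticOnNhd ℝ f U)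
    (hUv : ∀ x ∈ U, ∀ t : ℝ, x - t • v ∈ U) {x : E} (hx : x ∈ U) (u : E) (s : ℝ) :
    HasDerivAt (fun t => fderiv ℝ (lineIntegral f v) (t, x) (0, u)) (fderiv ℝ f (x - s • v) u) s := by
  have h0 := (analyticAt_lineIntegral hU hf hUv hx s).contDiffAt (n := 2)
  have h5 : ∀ᶠ z : ℝ × E in 𝓝 (s, x), fderiv ℝ (lineIntegral f v) z (1, 0) = f (z.2 - z.1 • v) := by
    have h3 : ∀ᶠ z : ℝ × E in 𝓝 (s, x), z.2 ∈ U :=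
      continuous_snd.continuousAt.eventually (hU.mem_nhds hx)
    filter_upwards [h3] with z hz
    exact fderiv_lineIntegral_fst hU hf hUv hz z.1
  have h6 : HasFDerivAt (fun z : ℝ × E => f (z.2 - z.1 • v)) ((fderiv ℝ f (x - s • v)).comp
      (ContinuousLinearMap.snd ℝ ℝ E - (ContinuousLinearMap.fst ℝ ℝ E).smulRight v)) (s, x) := by
    refine HasFDerivAt.comp (g := f) (f := fun z : ℝ × E => z.2 - z.1 • v) (s, x) ?_ ?_
    · exact (hf _ (hUv x hx s)).differentiableAt.hasFDerivAt
    · exact hasFDerivAt_snd.sub (hasFDerivAt_fst.smul_const v)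
  simpa using hasDerivAt_fderiv_snd h0 h5 h6 u

/-- Differentiation under the integral is avoided: the derivative along u has a known derivative in
s, by symmetry of mixed derivatives, and it vanishes at s = 0. -/
theorem fderiv_lineIntegral_snd (hU : IsOpen U) (hf : AnalyticOnNhd ℝ f U)
    (hUv : ∀ x ∈ U, ∀ t : ℝ, x - t • v ∈ U) {x : E} (hx : x ∈ U) (u : E) (s : ℝ) :
    fderiv ℝ (lineIntegral f v) (s, x) (0, u) = ∫ t in (0 : ℝ)..s, fderiv ℝ f (x - t • v) u := by
  have hc : Continuous fun t : ℝ => fderiv ℝ f (x - t • v) u :=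
    (continuous_line hf.fderiv hUv hx).clm_apply continuous_const
  rw [intervalIntegral.integral_eq_sub_of_hasDerivAt
    (fun t _ => hasDerivAt_fderiv_lineIntegral hU hf hUv hx u t) (hc.intervalIntegrable 0 s)]
  have h1 := (analyticAt_lineIntegral hU hf hUv hx 0).differentiableAt.hasFDerivAt
  have h2 : HasFDerivAt (fun y : E => ((0 : ℝ), y)) (ContinuousLinearMap.inr ℝ ℝ E) x :=
    (ContinuousLinearMap.inr ℝ ℝ E).hasFDerivAt
  have h3 := h1.comp x h2
  have h4 : lineIntegral f v ∘ (fun y : E => ((0 : ℝ), y)) = fun _ => 0 := by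
    funext y
    simp [lineIntegral]
  rw [h4] at h3
  have h5 := congrArg (fun L => L u) (h3.unique (hasFDerivAt_const (0 : F) x))
  have h6 : fderiv ℝ (lineIntegral f v) (0, x) (0, u) = 0 := by simpa using h5
  rw [h6, sub_zero]

/-- The derivative of `x ↦ ∫_0^{φ(x)} f(x - t v) dt`. -/
theorem hasFDerivAt_lineIntegral (hU : IsOpen U) (hf : AnalyticOnNhd ℝ f U)
    (hUv : ∀ x ∈ U, ∀ t : ℝ, x - t • v ∈ U) {x : E} (hx : x ∈ U) (φ : E →L[ℝ] ℝ) (u : E) :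
    fderiv ℝ (fun y => ∫ t in (0 : ℝ)..φ y, f (y - t • v)) x u =
      φ u • f (x - φ x • v) + ∫ t in (0 : ℝ)..φ x, fderiv ℝ f (x - t • v) u := by
  have h1 := (analyticAt_lineIntegral hU hf hUv hx (φ x)).differentiableAt.hasFDerivAt
  have h2 : HasFDerivAt (fun y : E => (φ y, y)) (φ.prod (ContinuousLinearMap.id ℝ E)) x :=
    φ.hasFDerivAt.prodMk (hasFDerivAt_id x)
  have h3 : HasFDerivAt (fun y => ∫ t in (0 : ℝ)..φ y, f (y - t • v)) _ x :=
    HasFDerivAt.comp (g := lineIntegral f v) (f := fun y : E => (φ y, y)) x h1 h2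
  rw [h3.fderiv]
  have h4 : ((φ u, u) : ℝ × E) = φ u • (1, 0) + (0, u) := by simp
  rw [ContinuousLinearMap.comp_apply, ContinuousLinearMap.prod_apply, ContinuousLinearMap.id_apply,
    h4, map_add, map_smul, fderiv_lineIntegral_fst hU hf hUv hx,
    fderiv_lineIntegral_snd hU hf hUv hx]

theorem analyticAt_integral_line (hU : IsOpen U) (hf : AnalyticOnNhd ℝ f U)
    (hUv : ∀ x ∈ U, ∀ t : ℝ, x - t • v ∈ U) {x : E} (hx : x ∈ U) (φ : E →L[ℝ] ℝ) :
    AnalyticAt ℝ (fun y => ∫ t in (0 : ℝ)..φ y, f (y - t • v)) x :=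
  AnalyticAt.fun_comp (g := lineIntegral f v) (f := fun y => (φ y, y))
    (analyticAt_lineIntegral hU hf hUv hx (φ x)) ((φ.analyticAt x).prod analyticAt_id)

end LineIntegral

/-! ### Rigidity of operators on analytic functions. -/

section AnalyticSpace

variable {V M : Type*} [NormedAddCommGroup V] [InnerProductSpace ℝ V]
  [NormedAddCommGroup M] [NormedSpace ℂ M]

theorem analyticSpace_ext {f g : AnalyticSpace V M} (h : ∀ x ∈ VHatPos V, f.1 x = g.1 x) : f = g := by
  refine Subtype.ext (funext fun x => ?_)
  by_cases hx : x ∈ VHatPos V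
  · exact h x hx
  · rw [f.2.2 x hx, g.2.2 x hx]

theorem isPreconnected_VHatPos : IsPreconnected (VHatPos V) :=
  ((convex_Ioi (0 : ℝ)).is_linear_preimage (f := fun x : VHat V => x.2.2)
    ⟨fun _ _ => rfl, fun _ _ => rfl⟩).isPreconnected

variable [FiniteDimensional ℂ M]

theorem iteratedFDeriv_eq_partialD_pow (f : AnalyticSpace V M) (u : VHat V) (n : ℕ) {x : VHat V}
    (hx : x ∈ VHatPos V) :
    iteratedFDeriv ℝ n f.1 x (fun _ => u) = ((partialD u ^ n) f).1 x := by
  have : CompleteSpace M := FiniteDimensional.complete ℂ M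
  induction n generalizing x with
  | zero => simp
  | succ n ih =>
    rw [iteratedFDeriv_succ_apply_left, pow_succ', Module.End.mul_apply, partialD_apply u _ hx]
    have h1 : ((partialD u ^ n) f).1 =ᶠ[𝓝 x] fun y => iteratedFDeriv ℝ n f.1 y fun _ => u := by
      filter_upwards [isOpen_VHatPos.mem_nhds hx] with y hy
      exact (ih hy).symm
    rw [h1.fderiv_eq]
    have h2 : DifferentiableAt ℝ (iteratedFDeriv ℝ n f.1) x :=
      (f.2.1.iteratedFDeriv n x hx).differentiableAt
    have h3 := (ContinuousMultilinearMap.apply ℝ (fun _ : Fin n => VHat V) M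
      fun _ => u).hasFDerivAt.comp x h2.hasFDerivAt
    have h4 : fderiv ℝ (fun y => iteratedFDeriv ℝ n f.1 y fun _ => u) x = _ := h3.fderiv
    rw [h4]
    rfl

/-- An analytic function all of whose iterated directional derivatives vanish at a point is zero. -/
theorem eq_zero_of_partialD_pow {f : AnalyticSpace V M} {x : VHat V} (hx : x ∈ VHatPos V)
    (h : ∀ (u : VHat V) (n : ℕ), ((partialD u ^ n) f).1 x = 0) : f = 0 := by
  have : CompleteSpace M := FiniteDimensional.complete ℂ M
  refine analyticSpace_ext fun y hy => ?_
  refine f.2.1.eqOn_zero_of_preconnected_of_eventuallyEq_zero isPreconnected_VHatPos hx ?_ hy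
  obtain ⟨p, r, hp⟩ := f.2.1 x hx
  filter_upwards [Metric.eball_mem_nhds x hp.r_pos] with z hz
  have hz' : z - x ∈ Metric.eball (0 : VHat V) r := by
    rwa [Metric.mem_eball, edist_zero_right, ← edist_eq_enorm_sub]
  have h1 := hp.hasSum_iteratedFDeriv hz'
  simp only [iteratedFDeriv_eq_partialD_pow f _ _ hx, h, smul_zero, add_sub_cancel] at h1
  exact h1.unique hasSum_zero

/-- An operator that intertwines directional derivatives and has values vanishing at a point
is zero. -/
theorem eq_zero_of_partialD_comm {X : Module.End ℂ (AnalyticSpace V M)} {x : VHat V}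
    (hx : x ∈ VHatPos V) (τ : VHat V → VHat V)
    (h : ∀ u f, partialD u (X f) = X (partialD (τ u) f)) (h0 : ∀ f, (X f).1 x = 0) : X = 0 := by
  ext1 f
  refine eq_zero_of_partialD_pow hx fun u n => ?_
  -- Each iterated derivative of X f is again a value of X, so it vanishes at x.
  have : ∀ f, (partialD u ^ n) (X f) = X ((partialD (τ u) ^ n) f) := by
    induction n with
    | zero => simp
    | succ n ih =>
      intro f
      rw [pow_succ, Module.End.mul_apply, h, ih, pow_succ, Module.End.mul_apply]
  rw [this, h0]

end AnalyticSpace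

namespace AffineRootDatum

/-! ### Integral operators, reflection operators and their commutation with derivatives. -/

section Operators

variable {ι V M : Type*} [NormedAddCommGroup V] [InnerProductSpace ℝ V]
  [NormedAddCommGroup M] [NormedSpace ℂ M]
  (D : AffineRootDatum ι V)

theorem snd_snd_eq_zero {a : VHat V} (ha : a ∈ D.affineRoots) : a.2.2 = 0 := by
  obtain ⟨i, m, rfl⟩ := ha
  rfl

theorem sub_smul_check_mem_iff (a : D.affineRoots) (x : VHat V) (t : ℝ) :
    x - t • hatCheck (a : VHat V) ∈ VHatPos V ↔ x ∈ VHatPos V := by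
  simp [VHatPos, hatCheck, D.snd_snd_eq_zero a.2]

theorem sub_form_smul_check (a x : VHat V) :
    x - hatForm a x • hatCheck a = hatReflection a x := by
  rw [hatReflection_apply, hatCheck, map_smul, hatForm_comm x a, smul_eq_mul, smul_smul, mul_comm]

theorem incl_s_coe (a : D.affineRoots) :
    ((D.incl (D.s a) : D.extWeyl) : VHat V ≃ₗ[ℝ] VHat V) = hatReflection (a : VHat V) := rfl

theorem s_mul_self (a : D.affineRoots) : D.s a * D.s a = 1 :=
  Subtype.ext (hatReflection_mul_self (a : VHat V))

theorem intervalIntegrable_line (a : D.affineRoots) (f : AnalyticSpace V M) {x : VHat V}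
    (hx : x ∈ VHatPos V) (r s : ℝ) :
    IntervalIntegrable (fun t => f.1 (x - t • hatCheck (a : VHat V))) MeasureTheory.volume r s :=
  (continuous_line f.2.1 (fun x hx t => (D.sub_smul_check_mem_iff a x t).2 hx)
    hx).intervalIntegrable r s

theorem inv_mem_VHatPos (w : D.extWeyl) {x : VHat V} (hx : x ∈ VHatPos V) :
    (w : VHat V ≃ₗ[ℝ] VHat V)⁻¹ x ∈ VHatPos V := by
  have := (D.extWeyl_props (inv_mem w.2)).2.1 x
  change 0 < ((w : VHat V ≃ₗ[ℝ] VHat V)⁻¹ x).2.2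
  rw [this]
  exact hx

variable [FiniteDimensional ℂ M]

theorem partialD_add_apply (u v : VHat V) (f : AnalyticSpace V M) :
    partialD (u + v) f = partialD u f + partialD v f :=
  congrArg (fun T => T f) ((partialR V M).map_add u v)

theorem partialD_smul_apply (r : ℝ) (u : VHat V) (f : AnalyticSpace V M) :
    partialD (r • u) f = (r : ℂ) • partialD u f := by
  have := congrArg (fun T => T f) ((partialR V M).map_smul r u)
  refine this.trans (Subtype.ext (funext fun x => ?_))
  exact (Complex.coe_smul r _).symm

variable [FiniteDimensional ℝ V]

/-- The continuous linear form `(a, ·)`. -/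
noncomputable def formCLM (a : VHat V) : VHat V →L[ℝ] ℝ := LinearMap.toContinuousLinearMap (hatForm a)

/-- The operator `(I(a)f)(x) = ∫_0^{(a, x)} f(x - t a^∨) dt`. -/
noncomputable def integralOp (a : D.affineRoots) : Module.End ℂ (AnalyticSpace V M) where
  toFun f := ⟨fun x => ∫ t in (0 : ℝ)..hatForm (a : VHat V) x, f.1 (x - t • hatCheck (a : VHat V)), by
    have : CompleteSpace M := FiniteDimensional.complete ℂ M
    refine ⟨fun x hx => analyticAt_integral_line isOpen_VHatPos f.2.1
      (fun x hx t => (D.sub_smul_check_mem_iff a x t).2 hx) hx (formCLM (a : VHat V)),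
      fun x hx => ?_⟩
    have : ∀ t : ℝ, f.1 (x - t • hatCheck (a : VHat V)) = 0 := fun t =>
      f.2.2 _ (by rwa [D.sub_smul_check_mem_iff])
    simp [this]⟩
  map_add' f g := analyticSpace_ext fun x hx =>
    intervalIntegral.integral_add (D.intervalIntegrable_line a f hx _ _)
      (D.intervalIntegrable_line a g hx _ _)
  map_smul' r f := analyticSpace_ext fun x _ => intervalIntegral.integral_smul r _

theorem integralOp_apply (a : D.affineRoots) (f : AnalyticSpace V M) (x : VHat V) :
    (D.integralOp a f).1 x =
      ∫ t in (0 : ℝ)..hatForm (a : VHat V) x, f.1 (x - t • hatCheck (a : VHat V)) := rfl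

theorem integralOp_apply_of_form_eq_zero (a : D.affineRoots) (f : AnalyticSpace V M) {x : VHat V}
    (h : hatForm (a : VHat V) x = 0) : (D.integralOp a f).1 x = 0 := by
  rw [integralOp_apply, h, intervalIntegral.integral_same]

theorem integralOp_partialD_apply (a : D.affineRoots) (u : VHat V) (f : AnalyticSpace V M)
    {x : VHat V} (hx : x ∈ VHatPos V) : (D.integralOp a (partialD u f)).1 x =
      ∫ t in (0 : ℝ)..hatForm (a : VHat V) x, fderiv ℝ f.1 (x - t • hatCheck (a : VHat V)) u := by
  rw [integralOp_apply]
  exact intervalIntegral.integral_congr fun t _ =>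
    partialD_apply u f ((D.sub_smul_check_mem_iff a x t).2 hx)

theorem partialD_integralOp (a : D.affineRoots) (u : VHat V) (f : AnalyticSpace V M) {x : VHat V}
    (hx : x ∈ VHatPos V) : (partialD u (D.integralOp a f)).1 x =
      hatForm (a : VHat V) u • f.1 (hatReflection (a : VHat V) x) +
        (D.integralOp a (partialD u f)).1 x := by
  have : CompleteSpace M := FiniteDimensional.complete ℂ M
  rw [partialD_apply u _ hx, D.integralOp_partialD_apply a u f hx, ← sub_form_smul_check]
  exact hasFDerivAt_lineIntegral isOpen_VHatPos f.2.1
    (fun x hx t => (D.sub_smul_check_mem_iff a x t).2 hx) hx (formCLM (a : VHat V)) u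

/-- The fundamental theorem of calculus on the segment from x to s_a x = x - (a, x) a^∨. -/
theorem integralOp_partialD_check (a : D.affineRoots) (f : AnalyticSpace V M) {x : VHat V}
    (hx : x ∈ VHatPos V) : (D.integralOp a (partialD (hatCheck (a : VHat V)) f)).1 x =
      f.1 x - f.1 (hatReflection (a : VHat V) x) := by
  have : CompleteSpace M := FiniteDimensional.complete ℂ M
  have hU : ∀ x ∈ VHatPos V, ∀ t : ℝ, x - t • hatCheck (a : VHat V) ∈ VHatPos V :=
    fun x hx t => (D.sub_smul_check_mem_iff a x t).2 hx
  have hc : Continuous fun t : ℝ =>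
      fderiv ℝ f.1 (x - t • hatCheck (a : VHat V)) (hatCheck (a : VHat V)) :=
    (continuous_line f.2.1.fderiv hU hx).clm_apply continuous_const
  have hd : ∀ t : ℝ, HasDerivAt (fun t : ℝ => -f.1 (x - t • hatCheck (a : VHat V)))
      (fderiv ℝ f.1 (x - t • hatCheck (a : VHat V)) (hatCheck (a : VHat V))) t := by
    intro t
    have h1 := (differentiableAt_analytic f (hU x hx t)).hasFDerivAt
    have h2 : HasDerivAt (fun t : ℝ => x - t • hatCheck (a : VHat V))
        (-((1 : ℝ) • hatCheck (a : VHat V))) t :=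
      ((hasDerivAt_id t).smul_const _).const_sub x
    have h3 := (h1.comp_hasDerivAt t h2).neg
    simp only [one_smul, map_neg, neg_neg] at h3
    exact h3
  rw [D.integralOp_partialD_apply a _ f hx, intervalIntegral.integral_eq_sub_of_hasDerivAt
    (fun t _ => hd t) (hc.intervalIntegrable _ _), sub_form_smul_check]
  simp only [zero_smul, sub_zero]
  abel

variable (π : Representation ℂ D.extWeyl M)

theorem act_apply (w : D.extWeyl) (f : AnalyticSpace V M) (x : VHat V) :
    (D.act π w f).1 x = π w (f.1 ((w : VHat V ≃ₗ[ℝ] VHat V)⁻¹ x)) := rfl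

theorem act_one : D.act π 1 = 1 := by
  ext f x
  simp [act_apply]

theorem act_mul (v w : D.extWeyl) : D.act π (v * w) = D.act π v * D.act π w := by
  ext f x
  simp only [act_apply, Module.End.mul_apply, map_mul, Subgroup.coe_mul, mul_inv_apply]

theorem partialD_act (w : D.extWeyl) (u : VHat V) (f : AnalyticSpace V M) :
    partialD u (D.act π w f) = D.act π w (partialD ((w : VHat V ≃ₗ[ℝ] VHat V)⁻¹ u) f) := by
  refine analyticSpace_ext fun x hx => ?_
  have hx' := D.inv_mem_VHatPos w hx
  rw [partialD_apply u _ hx, act_apply, partialD_apply _ _ hx']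
  let A : VHat V →L[ℝ] VHat V :=
    (((w⁻¹ : D.extWeyl).1 : VHat V →ₗ[ℝ] VHat V).toContinuousLinearMap)
  let B : M →L[ℝ] M := (LinearMap.toContinuousLinearMap (π w)).restrictScalars ℝ
  have h1 := (differentiableAt_analytic f hx').hasFDerivAt
  have h2 : HasFDerivAt (fun x => B (f.1 (A x))) _ x :=
    B.hasFDerivAt.comp x (HasFDerivAt.comp (g := f.1) (f := A) x h1 A.hasFDerivAt)
  change fderiv ℝ (fun x => B (f.1 (A x))) x u = _
  rw [h2.fderiv]
  rfl

/-- `w I(a) w⁻¹ = I(w a)`. -/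
theorem act_integralOp (w : D.extWeyl) {a b : D.affineRoots}
    (h : (b : VHat V) = (w : VHat V ≃ₗ[ℝ] VHat V) a) (f : AnalyticSpace V M) :
    D.act π w (D.integralOp a f) = D.integralOp b (D.act π w f) := by
  have : CompleteSpace M := FiniteDimensional.complete ℂ M
  refine analyticSpace_ext fun x hx => ?_
  have hf := (D.extWeyl_props w.2).1
  have hform : hatForm (b : VHat V) x = hatForm (a : VHat V) ((w : VHat V ≃ₗ[ℝ] VHat V)⁻¹ x) := by
    rw [hatForm_comm (a : VHat V), D.form_inv_left w.2, ← h, hatForm_comm]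
  have hcheck : (w : VHat V ≃ₗ[ℝ] VHat V)⁻¹ (hatCheck (b : VHat V)) = hatCheck (a : VHat V) := by
    rw [hatCheck, hatCheck, h, hf, map_smul]
    congr 1
    exact (w : VHat V ≃ₗ[ℝ] VHat V).symm_apply_apply _
  rw [act_apply, integralOp_apply, integralOp_apply, hform]
  simp only [act_apply, map_sub, map_smul, hcheck]
  have h1 := ContinuousLinearMap.intervalIntegral_comp_comm (𝕜 := ℂ)
    (LinearMap.toContinuousLinearMap (π w))
    (D.intervalIntegrable_line a f (D.inv_mem_VHatPos w hx) 0
      (hatForm (a : VHat V) ((w : VHat V ≃ₗ[ℝ] VHat V)⁻¹ x)))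
  exact h1.symm

variable (k : D.affineRoots → ℂ)

/-- The operator `s_a ⊗ π(s_a) - k_a I(a)`. -/
noncomputable def reflOp (a : D.affineRoots) : Module.End ℂ (AnalyticSpace V M) :=
  D.act π (D.incl (D.s a)) - k a • D.integralOp a

theorem act_s_apply (a : D.affineRoots) (f : AnalyticSpace V M) (x : VHat V) :
    (D.act π (D.incl (D.s a)) f).1 x =
      π (D.incl (D.s a)) (f.1 (hatReflection (a : VHat V) x)) := rfl

theorem reflOp_apply (a : D.affineRoots) (f : AnalyticSpace V M) (x : VHat V) :
    (D.reflOp π k a f).1 x = (D.act π (D.incl (D.s a)) f).1 x - k a • (D.integralOp a f).1 x := rfl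

theorem reflOp_apply_of_form_eq_zero (a : D.affineRoots) (f : AnalyticSpace V M) {x : VHat V}
    (h : hatForm (a : VHat V) x = 0) : (D.reflOp π k a f).1 x = π (D.incl (D.s a)) (f.1 x) := by
  rw [reflOp_apply, D.integralOp_apply_of_form_eq_zero a f h, act_s_apply,
    hatReflection_of_form_eq_zero h, smul_zero, sub_zero]

/-- The cross relation `∂_u Q_a = Q_a ∂_{s_a u} - k_a (a, u)`. -/
theorem partialD_reflOp (a : D.affineRoots) (u : VHat V) (f : AnalyticSpace V M) :
    partialD u (D.reflOp π k a f) = D.reflOp π k a (partialD (hatReflection (a : VHat V) u) f) -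
      (k a * (hatForm (a : VHat V) u : ℂ)) • f := by
  refine analyticSpace_ext fun x hx => ?_
  have hpos := (D.hatForm_self_pos a.2).ne'
  -- Replacing u by s_a u changes I(a) ∂_u f by -(a, u)(f - f ∘ s_a). Its f ∘ s_a part absorbs the
  -- boundary term of ∂_u I(a) f, and (a, u) f remains.
  have h1 : partialD (hatReflection (a : VHat V) u) f =
      partialD u f - (hatForm (a : VHat V) u : ℂ) • partialD (hatCheck (a : VHat V)) f := by
    rw [← sub_form_smul_check, sub_eq_add_neg, ← neg_smul, partialD_add_apply, partialD_smul_apply]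
    push_cast
    module
  have h2 := D.partialD_integralOp a u f hx
  have h3 := D.integralOp_partialD_check a f hx
  have h4 : (D.integralOp a (partialD (hatReflection (a : VHat V) u) f)).1 x =
      (D.integralOp a (partialD u f)).1 x - (hatForm (a : VHat V) u : ℂ) •
        (f.1 x - f.1 (hatReflection (a : VHat V) x)) := by
    rw [h1, map_sub, map_smul, ← h3]
    rfl
  have h5 : (partialD u (D.reflOp π k a f)).1 x =
      (partialD u (D.act π (D.incl (D.s a)) f)).1 x -
        k a • (partialD u (D.integralOp a f)).1 x := by
    rw [reflOp, LinearMap.sub_apply, LinearMap.smul_apply, map_sub, map_smul]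
    rfl
  have h6 : (D.reflOp π k a (partialD (hatReflection (a : VHat V) u) f) -
      (k a * (hatForm (a : VHat V) u : ℂ)) • f).1 x =
      (D.reflOp π k a (partialD (hatReflection (a : VHat V) u) f)).1 x -
        (k a * (hatForm (a : VHat V) u : ℂ)) • f.1 x := rfl
  rw [h5, h6, partialD_act, h2, reflOp_apply, h4, incl_s_coe, hatReflection_inv, ← Complex.coe_smul]
  module

/-- The point at which a simple root vanishes. -/
theorem exists_mem_VHatPos_form_eq_zero {a : VHat V} (ha : a ∈ D.simpleAffineRoots) :
    ∃ x ∈ VHatPos V, hatForm a x = 0 := by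
  obtain ⟨x, hx0, hx⟩ := D.exists_face_point {a}
  refine ⟨x, D.face_point_mem_VHatPos hx (D.nullRoot_notMem_closure
    (D.reflection_mem_extWeyl (D.simple_subset ha)) (J := {a}) ?_), hx0 a ha rfl⟩
  rintro _ rfl
  refine ⟨D.simple_pos ha, ?_⟩
  rw [hatReflection_inv, hatReflection_self (D.hatForm_self_pos (D.simple_subset ha)).ne', neg_neg]
  exact D.simple_pos ha

/-- Rigidity: the scalar terms of two successive cross relations cancel because (a, s_a u) = -(a,
u), so the square minus 1 commutes with all ∂_u. On the wall of a the operator acts as the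
involution π(s_a). -/
theorem reflOp_mul_self {a : D.affineRoots} (ha : (a : VHat V) ∈ D.simpleAffineRoots) :
    D.reflOp π k a * D.reflOp π k a = 1 := by
  obtain ⟨x, hx, hax⟩ := D.exists_mem_VHatPos_form_eq_zero ha
  refine sub_eq_zero.1 (eq_zero_of_partialD_comm hx id (fun u f => ?_) fun f => ?_)
  · simp only [LinearMap.sub_apply, Module.End.mul_apply, Module.End.one_apply, map_sub, id,
      partialD_reflOp, map_smul, hatReflection_hatReflection]
    rw [← hatForm_hatReflection_left, hatReflection_self (D.hatForm_self_pos a.2).ne']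
    simp only [map_neg, LinearMap.neg_apply, Complex.ofReal_neg]
    module
  · change (D.reflOp π k a (D.reflOp π k a f)).1 x - f.1 x = 0
    rw [reflOp_apply_of_form_eq_zero _ _ _ _ _ hax, reflOp_apply_of_form_eq_zero _ _ _ _ _ hax,
      ← Module.End.mul_apply, ← map_mul, ← map_mul, s_mul_self]
    simp

end Operators

end AffineRootDatum

namespace AffineRootDatum

/-! ### Length and descents in the affine Weyl group. -/

section Length

variable {ι V : Type*} [NormedAddCommGroup V] [InnerProductSpace ℝ V]
  (D : AffineRootDatum ι V)

/-- The length of `w ∈ Ŵ`: the number of its inversions. -/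
noncomputable def len (w : D.affineWeyl) : ℕ := (D.inversions (w : VHat V ≃ₗ[ℝ] VHat V)).ncard

/-- The simple root `a` is an inversion of `w`. -/
def IsDescent (w : D.affineWeyl) (a : D.affineRoots) : Prop :=
  (a : VHat V) ∈ D.simpleAffineRoots ∧ (a : VHat V) ∈ D.inversions (w : VHat V ≃ₗ[ℝ] VHat V)

theorem s_mul_s_mul (a : D.affineRoots) (w : D.affineWeyl) : D.s a * (D.s a * w) = w := by
  rw [← mul_assoc, s_mul_self, one_mul]

/-- The action of `s_a` on the affine roots. -/
noncomputable def reflRoot (a γ : D.affineRoots) : D.affineRoots :=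
  ⟨hatReflection (a : VHat V) γ,
    ((D.extWeyl_props (D.reflection_mem_extWeyl a.2)).2.2 γ).2 γ.2⟩

theorem s_reflRoot (a γ : D.affineRoots) : D.s (D.reflRoot a γ) = D.s a * D.s γ * D.s a := by
  refine Subtype.ext ?_
  have := hatReflection_map (hatReflection_form (a : VHat V)) (γ : VHat V)
  rwa [hatReflection_inv] at this

variable [FiniteDimensional ℝ V]

theorem isDescent_s_mul {w : D.affineWeyl} {a : D.affineRoots}
    (ha : (a : VHat V) ∈ D.simpleAffineRoots) : D.IsDescent (D.s a * w) a ↔ ¬ D.IsDescent w a := by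
  have := D.mem_inversions_reflection_mul (D.affineWeyl_le w.2) (D.simple_pos ha)
  simp only [IsDescent, ha, true_and]
  exact this

theorem len_one : D.len 1 = 0 := by
  rw [len, Subgroup.coe_one, inversions_one, Set.ncard_empty]

variable [Finite ι]

theorem len_of_isDescent {w : D.affineWeyl} {a : D.affineRoots} (h : D.IsDescent w a) :
    D.len w = D.len (D.s a * w) + 1 :=
  D.ncard_inversions_of_mem (D.affineWeyl_le w.2) h.1 h.2

theorem exists_isDescent {w : D.affineWeyl} (h : D.len w ≠ 0) : ∃ a, D.IsDescent w a := by
  have hw := D.affineWeyl_le w.2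
  obtain ⟨a, ha, haw⟩ := D.exists_simple_mem_inversions hw
    ((Set.ncard_pos (D.inversions_finite hw)).1 (Nat.pos_of_ne_zero h))
  exact ⟨⟨a, D.simple_subset ha⟩, ha, haw⟩

theorem eq_one_of_len_eq_zero {w : D.affineWeyl} (h : D.len w = 0) : w = 1 :=
  Subtype.ext (D.eq_one_of_inversions_eq_empty w.2
    ((Set.ncard_eq_zero (D.inversions_finite (D.affineWeyl_le w.2))).1 h))

/-- The inversions of `w ∈ Ŵ`, as a finite set of affine roots. -/
noncomputable def invFinset (w : D.affineWeyl) : Finset D.affineRoots :=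
  ((D.inversions_finite (D.affineWeyl_le w.2)).preimage
    (f := ((↑) : D.affineRoots → VHat V)) Subtype.val_injective.injOn).toFinset

theorem mem_invFinset {w : D.affineWeyl} {γ : D.affineRoots} :
    γ ∈ D.invFinset w ↔ (γ : VHat V) ∈ D.inversions (w : VHat V ≃ₗ[ℝ] VHat V) := by
  simp [invFinset]

theorem len_s_mul_lt {w : D.affineWeyl} {γ : D.affineRoots} (h : γ ∈ D.invFinset w) :
    D.len (D.s γ * w) < D.len w :=
  D.ncard_inversions_reflection_lt w.2 (D.mem_invFinset.1 h)

-- Besides a, the inversions of s_a w are the s_a γ for γ an inversion of w; this reindexes the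
-- correction terms of the cross relation.
open Classical in
theorem sum_invFinset_s_mul {A : Type*} [AddCommMonoid A] {w : D.affineWeyl} {a : D.affineRoots}
    (ha : (a : VHat V) ∈ D.simpleAffineRoots) (h : ¬ D.IsDescent w a) (φ : D.affineRoots → A) :
    ∑ γ ∈ D.invFinset (D.s a * w), φ γ = φ a + ∑ γ ∈ D.invFinset w, φ (D.reflRoot a γ) := by
  have hw := D.affineWeyl_le w.2
  have h' : (a : VHat V) ∉ D.inversions (w : VHat V ≃ₗ[ℝ] VHat V) := fun h' => h ⟨ha, h'⟩
  have hins := D.inversions_simple_mul hw ha h'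
  have hnot := D.notMem_image_inversions (w := (w : VHat V ≃ₗ[ℝ] VHat V)) ha
  have h1 : D.invFinset (D.s a * w) = insert a ((D.invFinset w).image (D.reflRoot a)) := by
    ext γ
    rw [mem_invFinset, Finset.mem_insert, Finset.mem_image]
    change (γ : VHat V) ∈ D.inversions (hatReflection (a : VHat V) * _) ↔ _
    rw [hins]
    constructor
    · rintro (h | ⟨δ, hδ, h⟩)
      · exact Or.inl (Subtype.ext h)
      · exact Or.inr ⟨⟨δ, hδ.1.1⟩, D.mem_invFinset.2 hδ, Subtype.ext h⟩
    · rintro (rfl | ⟨δ, hδ, rfl⟩)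
      · exact Or.inl rfl
      · exact Or.inr ⟨δ, D.mem_invFinset.1 hδ, rfl⟩
  rw [h1, Finset.sum_insert, Finset.sum_image]
  · intro γ _ δ _ h
    exact Subtype.ext ((hatReflection (a : VHat V)).injective (congrArg Subtype.val h))
  · rw [Finset.mem_image]
    rintro ⟨δ, hδ, h⟩
    exact hnot ⟨δ, D.mem_invFinset.1 hδ, congrArg Subtype.val h⟩

end Length

/-! ### Existence of the integral-reflection representation. -/

section Existence

variable {ι V M : Type*} [NormedAddCommGroup V] [InnerProductSpace ℝ V]
  [NormedAddCommGroup M] [NormedSpace ℂ M] (D : AffineRootDatum ι V)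
  [FiniteDimensional ℝ V] [FiniteDimensional ℂ M]
  (π : Representation ℂ D.extWeyl M) (k : D.affineRoots → ℂ)

open Classical in
/-- The integral-reflection operator of `w ∈ Ŵ`, a product of operators of simple reflections along
a reduced expression. -/
noncomputable def qOp [Finite ι] (w : D.affineWeyl) : Module.End ℂ (AnalyticSpace V M) :=
  if h : ∃ a, D.IsDescent w a then D.reflOp π k h.choose * qOp (D.s h.choose * w) else 1
termination_by D.len w
decreasing_by
  have := D.len_of_isDescent h.choose_spec
  omega

variable [Finite ι]

theorem qOp_one : D.qOp π k 1 = 1 := by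
  rw [qOp, dif_neg]
  rintro ⟨a, ha⟩
  have := D.len_of_isDescent ha
  rw [len_one] at this
  omega

theorem exists_qOp_eq {w : D.affineWeyl} (h : ∃ a, D.IsDescent w a) :
    ∃ a, D.IsDescent w a ∧ D.qOp π k w = D.reflOp π k a * D.qOp π k (D.s a * w) := by
  refine ⟨h.choose, h.choose_spec, ?_⟩
  rw [qOp, dif_pos h]

/-- Up to length `n`, the operators do not depend on the reduced expression. -/
def QOpCompatible (n : ℕ) : Prop :=
  ∀ (w : D.affineWeyl) (a : D.affineRoots), D.len w ≤ n → D.IsDescent w a →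
    D.qOp π k w = D.reflOp π k a * D.qOp π k (D.s a * w)

variable {D π k}

/-- If a is a descent of v, compatibility at v is multiplied by the involution `reflOp`. Otherwise a
is a descent of s_a v, and the strict bound on v keeps the length of s_a v at most n. -/
theorem QOpCompatible.reflOp_mul {n : ℕ} (h : D.QOpCompatible π k n) {v : D.affineWeyl}
    {a : D.affineRoots} (ha : (a : VHat V) ∈ D.simpleAffineRoots) (hv : D.len v < n) :
    D.reflOp π k a * D.qOp π k v = D.qOp π k (D.s a * v) := by
  by_cases hav : D.IsDescent v a
  · rw [h v a hv.le hav, ← mul_assoc, D.reflOp_mul_self π k ha, one_mul]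
  · have hd := (D.isDescent_s_mul ha).2 hav
    have hl := D.len_of_isDescent hd
    rw [s_mul_s_mul] at hl
    rw [h (D.s a * v) a (by omega) hd, s_mul_s_mul]

variable (D π k)

/-- The commutation rule of `Q` with the directional derivatives, where
`∂_u Q = Q ∂_{w⁻¹ u} - ∑_γ k_γ (γ, u) Q̂(s_γ w)`, the sum being over the inversions of `w`. -/
def CrossRelation (w : D.affineWeyl) (Q : Module.End ℂ (AnalyticSpace V M)) : Prop :=
  ∀ u f, partialD u (Q f) = Q (partialD ((w : VHat V ≃ₗ[ℝ] VHat V)⁻¹ u) f) -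
    ∑ γ ∈ D.invFinset w, (k γ * (hatForm (γ : VHat V) u : ℂ)) • D.qOp π k (D.s γ * w) f

variable {D π k}

/-- Because s_{s_a γ} s_a v = s_a s_γ v, applying `reflOp` to the relation for v gives every
correction term except that of a, which is the scalar term of `partialD_reflOp`. Each s_γ v is
shorter than v, so compatibility up to n suffices although s_a v may have length n + 1. -/
theorem QOpCompatible.crossRelation_step (hk : D.IsMultiplicityFunction k) {n : ℕ}
    (h : D.QOpCompatible π k n) {v : D.affineWeyl} {a : D.affineRoots}
    (ha : (a : VHat V) ∈ D.simpleAffineRoots) (hav : ¬ D.IsDescent v a) (hv : D.len v ≤ n)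
    (hc : D.CrossRelation π k v (D.qOp π k v)) :
    D.CrossRelation π k (D.s a * v) (D.reflOp π k a * D.qOp π k v) := by
  intro u f
  rw [Module.End.mul_apply, partialD_reflOp, hc, D.sum_invFinset_s_mul ha hav, s_mul_s_mul, map_sub,
    map_sum]
  have h1 : ((D.s a * v : D.affineWeyl) : VHat V ≃ₗ[ℝ] VHat V)⁻¹ u =
      (v : VHat V ≃ₗ[ℝ] VHat V)⁻¹ (hatReflection (a : VHat V) u) :=
    reflection_mul_inv_apply _ _ _
  have h2 : ∀ γ ∈ D.invFinset v, D.reflOp π k a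
      ((k γ * (hatForm (γ : VHat V) (hatReflection (a : VHat V) u) : ℂ)) •
        D.qOp π k (D.s γ * v) f) =
      (k (D.reflRoot a γ) * (hatForm (D.reflRoot a γ : VHat V) u : ℂ)) •
        D.qOp π k (D.s (D.reflRoot a γ) * (D.s a * v)) f := by
    intro γ hγ
    have hlt := D.len_s_mul_lt hγ
    have h3 := h.reflOp_mul ha (hlt.trans_le hv)
    have h4 : k (D.reflRoot a γ) = k γ := hk (D.incl (D.s a)) γ (D.reflRoot a γ) rfl
    have h5 : hatForm (D.reflRoot a γ : VHat V) u =
        hatForm (γ : VHat V) (hatReflection (a : VHat V) u) := hatForm_hatReflection_left _ _ _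
    rw [map_smul, ← Module.End.mul_apply, h3, h4, h5, s_reflRoot]
    congr 3
    rw [mul_assoc, s_mul_s_mul, mul_assoc]
  rw [Finset.sum_congr rfl h2, h1, Module.End.mul_apply]
  abel

theorem QOpCompatible.crossRelation (hk : D.IsMultiplicityFunction k) {n : ℕ}
    (h : D.QOpCompatible π k n) {w : D.affineWeyl} (hw : D.len w ≤ n) :
    D.CrossRelation π k w (D.qOp π k w) := by
  induction hm : D.len w generalizing w with
  | zero =>
    have : w = 1 := D.eq_one_of_len_eq_zero hm
    subst this
    intro u f
    have h1 : D.invFinset 1 = ∅ := by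
      ext γ
      rw [mem_invFinset, Subgroup.coe_one, inversions_one]
      simp
    rw [h1, qOp_one]
    simp
  | succ m ih =>
    obtain ⟨a, ha⟩ := D.exists_isDescent (w := w) (by omega)
    have hl := D.len_of_isDescent ha
    have hnd : ¬ D.IsDescent (D.s a * w) a := fun h' => (D.isDescent_s_mul ha.1).1 h' ha
    have := h.crossRelation_step hk ha.1 hnd (by omega) (ih (by omega) (by omega))
    rw [s_mul_s_mul] at this
    rwa [h w a hw ha]

/-- Values of the operators at a point where two simple roots vanish. -/
theorem QOpCompatible.exists_minimal {n : ℕ} (h : D.QOpCompatible π k n) {a b : D.affineRoots}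
    (ha : (a : VHat V) ∈ D.simpleAffineRoots) (hb : (b : VHat V) ∈ D.simpleAffineRoots) {x : VHat V}
    (hax : hatForm (a : VHat V) x = 0) (hbx : hatForm (b : VHat V) x = 0) {v : D.affineWeyl}
    (hv : D.len v ≤ n) :
    ∃ g v' : D.affineWeyl, v = g * v' ∧ (g : VHat V ≃ₗ[ℝ] VHat V) ∈
        Subgroup.closure {hatReflection (a : VHat V), hatReflection (b : VHat V)} ∧
      (¬ D.IsDescent v' a ∧ ¬ D.IsDescent v' b) ∧
      ∀ f, (D.qOp π k v f).1 x = π (D.incl g) ((D.qOp π k v' f).1 x) := by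
  induction hm : D.len v using Nat.strong_induction_on generalizing v with
  | _ m ih =>
    -- Descents among a and b are stripped from the left; at x each stripped operator acts through π
    -- alone, as the integral vanishes.
    by_cases hd : ∃ c, (c = a ∨ c = b) ∧ D.IsDescent v c
    · obtain ⟨c, hc, hcd⟩ := hd
      have hl := D.len_of_isDescent hcd
      obtain ⟨g, v', hg, hgc, hv', hq⟩ := ih (D.len (D.s c * v)) (by omega) (by omega) rfl
      have hcx : hatForm (c : VHat V) x = 0 := by rcases hc with rfl | rfl <;> assumption
      refine ⟨D.s c * g, v', ?_, mul_mem (Subgroup.subset_closure ?_) hgc, hv', fun f => ?_⟩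
      · rw [mul_assoc, ← hg, s_mul_s_mul]
      · rcases hc with rfl | rfl
        · exact Or.inl rfl
        · exact Or.inr rfl
      · rw [h v c hv hcd, Module.End.mul_apply, D.reflOp_apply_of_form_eq_zero π k c _ hcx, hq,
          map_mul, map_mul, Module.End.mul_apply]
    · push Not at hd
      exact ⟨1, v, (one_mul v).symm, one_mem _, ⟨hd a (Or.inl rfl), hd b (Or.inr rfl)⟩, by simp⟩

/-- Rigidity applied to two descents a and b of w: the two products obey one cross relation with
identical correction terms, and they agree at a common zero of a and b. -/
theorem QOpCompatible.succ (hk : D.IsMultiplicityFunction k) {n : ℕ}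
    (h : D.QOpCompatible π k n) : D.QOpCompatible π k (n + 1) := by
  intro w a hw ha
  obtain ⟨b, hb, hq⟩ := D.exists_qOp_eq π k ⟨a, ha⟩
  rw [hq]
  have key : ∀ {c}, D.IsDescent w c →
      D.CrossRelation π k w (D.reflOp π k c * D.qOp π k (D.s c * w)) := by
    intro c hc
    have hl := D.len_of_isDescent hc
    have hnd : ¬ D.IsDescent (D.s c * w) c := fun h' => (D.isDescent_s_mul hc.1).1 h' hc
    have := h.crossRelation_step hk hc.1 hnd (by omega) (h.crossRelation hk (by omega))
    rwa [s_mul_s_mul] at this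
  obtain ⟨x, hx0, hx⟩ := D.exists_face_point {(a : VHat V), (b : VHat V)}
  have hax := hx0 a ha.1 (Or.inl rfl)
  have hbx := hx0 b hb.1 (Or.inr rfl)
  -- As a and b are both inversions of w, c is not a sum of copies of them, so x can be used as a
  -- point of the open half space.
  have hxpos := D.face_point_mem_VHatPos hx (D.nullRoot_notMem_closure (D.affineWeyl_le w.2) (by
    rintro _ (rfl | rfl)
    · exact ha.2
    · exact hb.2))
  refine sub_eq_zero.1 (eq_zero_of_partialD_comm hxpos (fun u => (w : VHat V ≃ₗ[ℝ] VHat V)⁻¹ u)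
    (fun u f => ?_) fun f => ?_)
  · rw [LinearMap.sub_apply, map_sub, key hb, key ha, LinearMap.sub_apply]
    abel
  · change (D.reflOp π k b (D.qOp π k (D.s b * w) f)).1 x -
      (D.reflOp π k a (D.qOp π k (D.s a * w) f)).1 x = 0
    have hla := D.len_of_isDescent ha
    have hlb := D.len_of_isDescent hb
    obtain ⟨g₁, v₁, h1, hg₁, hm₁, hq₁⟩ :=
      h.exists_minimal ha.1 hb.1 hax hbx (v := D.s a * w) (by omega)
    obtain ⟨g₂, v₂, h2, hg₂, hm₂, hq₂⟩ :=
      h.exists_minimal ha.1 hb.1 hax hbx (v := D.s b * w) (by omega)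
    have hw1 : w = D.s a * g₁ * v₁ := by rw [mul_assoc, ← h1, s_mul_s_mul]
    have hw2 : w = D.s b * g₂ * v₂ := by rw [mul_assoc, ← h2, s_mul_s_mul]
    -- Both v₁ and v₂ are minimal in the coset of w under the subgroup generated by s_a and s_b, so
    -- they coincide.
    have hg : (D.s b * g₂)⁻¹ * (D.s a * g₁) = 1 := by
      have hv2 : ((D.s b * g₂)⁻¹ * (D.s a * g₁)) * v₁ = v₂ := by
        rw [mul_assoc, ← hw1, inv_mul_eq_iff_eq_mul]
        exact hw2
      refine Subtype.ext (D.eq_one_of_minimal ha.1 hb.1 (v := (v₁ : VHat V ≃ₗ[ℝ] VHat V)) ?_ v₁.2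
        ?_ ?_)
      · exact mul_mem (inv_mem (mul_mem (Subgroup.subset_closure (Or.inr rfl)) hg₂))
          (mul_mem (Subgroup.subset_closure (Or.inl rfl)) hg₁)
      · rintro _ (rfl | rfl) h'
        · exact hm₁.1 ⟨ha.1, h'⟩
        · exact hm₁.2 ⟨hb.1, h'⟩
      · rw [← Subgroup.coe_mul, hv2]
        rintro _ (rfl | rfl) h'
        · exact hm₂.1 ⟨ha.1, h'⟩
        · exact hm₂.2 ⟨hb.1, h'⟩
    have hgg : D.s a * g₁ = D.s b * g₂ := (inv_mul_eq_one.1 hg).symm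
    have hvv : v₁ = v₂ := by
      have := hw1.symm.trans hw2
      rw [hgg] at this
      exact mul_left_cancel this
    rw [reflOp_apply_of_form_eq_zero _ _ _ _ _ hbx, reflOp_apply_of_form_eq_zero _ _ _ _ _ hax,
      hq₁, hq₂, ← Module.End.mul_apply, ← Module.End.mul_apply, ← map_mul, ← map_mul, ← map_mul,
      ← map_mul, hgg, hvv, sub_self]

variable (D π k)

theorem qOpCompatible (hk : D.IsMultiplicityFunction k) (n : ℕ) : D.QOpCompatible π k n := by
  induction n with
  | zero =>
    intro w a hw ha
    have := D.len_of_isDescent ha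
    omega
  | succ n ih => exact ih.succ hk

theorem qOp_s_mul (hk : D.IsMultiplicityFunction k) {a : D.affineRoots}
    (ha : (a : VHat V) ∈ D.simpleAffineRoots) (v : D.affineWeyl) :
    D.qOp π k (D.s a * v) = D.reflOp π k a * D.qOp π k v :=
  ((D.qOpCompatible π k hk (D.len v + 1)).reflOp_mul ha (Nat.lt_succ_self _)).symm

/-- The integral-reflection representation of the affine Weyl group. -/
noncomputable def integralReflectionRep (hk : D.IsMultiplicityFunction k) :
    Representation ℂ D.affineWeyl (AnalyticSpace V M) where
  toFun := D.qOp π k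
  map_one' := D.qOp_one π k
  map_mul' v w := by
    induction v using D.affineWeyl_induction with
    | one => rw [one_mul, qOp_one, one_mul]
    | mul a v ha ih => rw [mul_assoc, D.qOp_s_mul π k hk ha, ih, D.qOp_s_mul π k hk ha, mul_assoc]

theorem isIntegralReflection_integralReflectionRep (hk : D.IsMultiplicityFunction k) :
    D.IsIntegralReflection π k (D.integralReflectionRep π k hk) := by
  intro a ha f x _
  have : D.qOp π k (D.s a) = D.reflOp π k a := by
    simpa [qOp_one] using D.qOp_s_mul π k hk ha 1
  change (D.qOp π k (D.s a) f).1 x = _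
  rw [this]
  rfl

/-- `Q` is a choice, with the trivial default, so its defining formula becomes available only
through the existence of a representation satisfying it. -/
theorem isIntegralReflection_Q (hk : D.IsMultiplicityFunction k) :
    D.IsIntegralReflection π k (D.Q π k) :=
  Classical.epsilon_spec (p := D.IsIntegralReflection π k)
    ⟨_, D.isIntegralReflection_integralReflectionRep π k hk⟩

theorem Q_s (hk : D.IsMultiplicityFunction k) {a : D.affineRoots}
    (ha : (a : VHat V) ∈ D.simpleAffineRoots) : D.Q π k (D.s a) = D.reflOp π k a := by
  ext1 f
  exact analyticSpace_ext fun x hx => D.isIntegralReflection_Q π k hk a ha f x hx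

end Existence

end AffineRootDatum

/-! ### Divided differences on the symmetric algebra. -/

section DividedDifference

variable {V : Type*} [NormedAddCommGroup V] [InnerProductSpace ℝ V]

/-- The linear form (b, ·) extends to an algebra homomorphism to ℂ, which takes the value (b, b^∨) =
2 here. -/
theorem deg1_hatCheck_ne_zero {b : VHat V} (hb : hatForm b b ≠ 0) : deg1 (hatCheck b) ≠ 0 := by
  let φ : HHat V →ₗ[ℂ] ℂ :=
    (Complex.ofRealCLM.toLinearMap ∘ₗ hatForm b : VHat V →ₗ[ℝ] ℂ).liftBaseChange ℂ
  have h : SymmetricAlgebra.lift φ (deg1 (hatCheck b)) = 2 := by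
    rw [deg1, SymmetricAlgebra.lift_ι_apply]
    simp [φ, AffineRootDatum.hatForm_hatCheck_self hb]
  intro h0
  rw [h0, map_zero] at h
  exact two_ne_zero h.symm

/-- Cancellation of b^∨ in the domain S(ĥ) removes the arbitrariness of the chosen quotient. -/
theorem dividedDiff_unique {b : VHat V} (hb : hatForm b b ≠ 0) {p q : SHat V}
    (h : deg1 (hatCheck b) * q = symAct (hatReflection b) p - p) : dividedDiff b p = q :=
  mul_left_cancel₀ (deg1_hatCheck_ne_zero hb) ((dividedDiff_spec b p).trans h.symm)

theorem dividedDiff_add {b : VHat V} (hb : hatForm b b ≠ 0) (p q : SHat V) :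
    dividedDiff b (p + q) = dividedDiff b p + dividedDiff b q := by
  refine dividedDiff_unique hb ?_
  rw [mul_add, dividedDiff_spec, dividedDiff_spec, map_add]
  ring

/-- Twisted Leibniz rule, from s(pq) - pq = (sp - p) sq + p (sq - q). -/
theorem dividedDiff_mul {b : VHat V} (hb : hatForm b b ≠ 0) (p q : SHat V) :
    dividedDiff b (p * q) =
      dividedDiff b p * symAct (hatReflection b) q + p * dividedDiff b q := by
  refine dividedDiff_unique hb ?_
  rw [mul_add, ← mul_assoc, mul_left_comm _ p, dividedDiff_spec, dividedDiff_spec, map_mul]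
  ring

theorem dividedDiff_algebraMap {b : VHat V} (hb : hatForm b b ≠ 0) (r : ℂ) :
    dividedDiff b (algebraMap ℂ (SHat V) r) = 0 := by
  refine dividedDiff_unique hb ?_
  rw [AlgHom.commutes, sub_self, mul_zero]

theorem symAct_deg1 (g : VHat V ≃ₗ[ℝ] VHat V) (u : VHat V) : symAct g (deg1 u) = deg1 (g u) := by
  simp [symAct, deg1]

theorem deg1_sub_smul (u v : VHat V) (r : ℝ) :
    deg1 (u - r • v) = deg1 u - algebraMap ℂ _ (r : ℂ) * deg1 v := by
  rw [← Algebra.smul_def, deg1, deg1, deg1, TensorProduct.tmul_sub, map_sub, ← map_smul,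
    TensorProduct.tmul_smul, Complex.coe_smul]
  rfl

theorem dividedDiff_deg1 {b : VHat V} (hb : hatForm b b ≠ 0) (u : VHat V) :
    dividedDiff b (deg1 u) = algebraMap ℂ _ (-(hatForm b u : ℂ)) := by
  refine dividedDiff_unique hb ?_
  rw [symAct_deg1, ← AffineRootDatum.sub_form_smul_check, deg1_sub_smul, map_neg]
  ring

/-- The symmetric algebra is generated by the elements of degree one of `V̂`. -/
theorem symmetricAlgebra_induction {P : SHat V → Prop} (scalar : ∀ r, P (algebraMap ℂ _ r))
    (vector : ∀ u, P (deg1 u)) (add : ∀ p q, P p → P q → P (p + q))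
    (mul : ∀ p q, P p → P q → P (p * q)) (p : SHat V) : P p := by
  induction p using SymmetricAlgebra.induction with
  | algebraMap r => exact scalar r
  | ι x =>
    induction x using TensorProduct.induction_on with
    | zero => simpa using scalar 0
    | add x y hx hy => rw [map_add]; exact add _ _ hx hy
    | tmul r x =>
      have : SymmetricAlgebra.ι ℂ (HHat V) (r ⊗ₜ x) = algebraMap ℂ _ r * deg1 x := by
        rw [← Algebra.smul_def, deg1, ← map_smul, TensorProduct.smul_tmul', smul_eq_mul,
          mul_one]
      rw [this]
      exact mul _ _ (scalar r) (vector x)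
  | mul p q hp hq => exact mul p q hp hq
  | add p q hp hq => exact add p q hp hq

end DividedDifference

/-! ### Endomorphisms of M commute with constant coefficient operators. -/

section PostComposition

variable {V M : Type*} [NormedAddCommGroup V] [InnerProductSpace ℝ V]
  [NormedAddCommGroup M] [NormedSpace ℂ M] [FiniteDimensional ℂ M]

/-- Composition of functions with an endomorphism of `M`. -/
noncomputable def postComp (B : Module.End ℂ M) : Module.End ℂ (AnalyticSpace V M) where
  toFun f := ⟨fun x => B (f.1 x), fun x hx => AnalyticAt.fun_comp (g := fun m => B m)
    (((LinearMap.toContinuousLinearMap B).restrictScalars ℝ).analyticAt _) (f.2.1 x hx),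
    fun x hx => by
      change B (f.1 x) = 0
      rw [f.2.2 x hx, map_zero]⟩
  map_add' f g := by ext x; simp
  map_smul' r f := by ext x; simp

theorem postComp_apply (B : Module.End ℂ M) (f : AnalyticSpace V M) (x : VHat V) :
    (postComp B f).1 x = B (f.1 x) := rfl

theorem partialD_postComp (B : Module.End ℂ M) (u : VHat V) :
    partialD u * postComp B = (postComp B * partialD u : Module.End ℂ (AnalyticSpace V M)) := by
  ext1 f
  refine analyticSpace_ext fun x hx => ?_
  let C : M →L[ℝ] M := (LinearMap.toContinuousLinearMap B).restrictScalars ℝ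
  have h : HasFDerivAt (fun x => C (f.1 x)) _ x :=
    C.hasFDerivAt.comp x (differentiableAt_analytic f hx).hasFDerivAt
  rw [Module.End.mul_apply, Module.End.mul_apply, postComp_apply, partialD_apply u _ hx,
    partialD_apply u _ hx]
  change fderiv ℝ (fun x => C (f.1 x)) x u = _
  rw [h.fderiv]
  rfl

theorem diffOp_postComp (B : Module.End ℂ M) (p : SHat V) :
    diffOp V M p * postComp B = postComp B * diffOp V M p := by
  induction p using symmetricAlgebra_induction with
  | scalar r => rw [AlgHom.commutes]; exact Algebra.commutes r _
  | vector u => rw [diffOp_deg1, partialD_postComp]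
  | add p q hp hq => rw [map_add, add_mul, mul_add, hp, hq]
  | mul p q hp hq => rw [map_mul, mul_assoc, hq, ← mul_assoc, hp, mul_assoc]

end PostComposition

namespace AffineRootDatum

/-! ### The jump operator and the components of T f. -/

section Jump

variable {ι V M : Type*} [NormedAddCommGroup V] [InnerProductSpace ℝ V]
  [FiniteDimensional ℝ V] [NormedAddCommGroup M] [NormedSpace ℂ M] [FiniteDimensional ℂ M]
  (D : AffineRootDatum ι V) (π : Representation ℂ D.extWeyl M)

/-- The operator `(s_b ⊗ π(s_b)) I(b)`. -/
noncomputable def jumpOp (b : D.affineRoots) : Module.End ℂ (AnalyticSpace V M) :=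
  D.act π (D.incl (D.s b)) * D.integralOp b

theorem jumpOp_apply_of_form_eq_zero (b : D.affineRoots) (f : AnalyticSpace V M) {x : VHat V}
    (h : hatForm (b : VHat V) x = 0) : (D.jumpOp π b f).1 x = 0 := by
  rw [jumpOp, Module.End.mul_apply, act_s_apply, hatReflection_of_form_eq_zero h,
    D.integralOp_apply_of_form_eq_zero b f h, map_zero]

/-- Moving ∂_u past s_b turns it into ∂_{s_b u}. The boundary term of I(b) is then f composed with
s_b twice, that is f, with coefficient (b, s_b u) = -(b, u). -/
theorem partialD_jumpOp (b : D.affineRoots) (u : VHat V) :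
    partialD u * D.jumpOp π b = D.jumpOp π b * partialD (hatReflection (b : VHat V) u) +
      postComp (π (D.incl (D.s b))) *
        algebraMap ℂ (Module.End ℂ (AnalyticSpace V M)) (-(hatForm (b : VHat V) u : ℂ)) := by
  ext1 f
  refine analyticSpace_ext fun x hx => ?_
  have hx' := D.inv_mem_VHatPos (D.incl (D.s b)) hx
  rw [incl_s_coe, hatReflection_inv] at hx'
  have h1 := D.partialD_integralOp b (hatReflection (b : VHat V) u) f hx'
  rw [hatReflection_hatReflection] at h1
  have h2 : hatForm (b : VHat V) (hatReflection (b : VHat V) u) = -hatForm (b : VHat V) u := by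
    rw [← hatForm_hatReflection_left, hatReflection_self (D.hatForm_self_pos b.2).ne', map_neg,
      LinearMap.neg_apply]
  have h3 : partialD u (D.jumpOp π b f) = D.act π (D.incl (D.s b))
      (partialD (hatReflection (b : VHat V) u) (D.integralOp b f)) := by
    rw [jumpOp, Module.End.mul_apply, partialD_act, incl_s_coe, hatReflection_inv]
  rw [Module.End.mul_apply, h3, act_s_apply, h1, h2, ← Complex.coe_smul, Complex.ofReal_neg, map_add,
    add_comm, map_smul]
  rw [LinearMap.add_apply, Module.End.mul_apply, Module.End.mul_apply,
    Module.algebraMap_end_apply, map_smul]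
  rfl

/-- The degree one case extends to products by the twisted Leibniz rule, since p(∂) commutes with
π(s_b). -/
theorem diffOp_jumpOp (b : D.affineRoots) (p : SHat V) :
    diffOp V M p * D.jumpOp π b =
      D.jumpOp π b * diffOp V M (symAct (hatReflection (b : VHat V)) p) +
        postComp (π (D.incl (D.s b))) * diffOp V M (dividedDiff (b : VHat V) p) := by
  have hb := (D.hatForm_self_pos b.2).ne'
  induction p using symmetricAlgebra_induction with
  | scalar r =>
    rw [AlgHom.commutes, AlgHom.commutes, AlgHom.commutes, dividedDiff_algebraMap hb, map_zero,
      mul_zero, add_zero]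
    exact Algebra.commutes r _
  | vector u =>
    rw [diffOp_deg1, symAct_deg1, diffOp_deg1, dividedDiff_deg1 hb, AlgHom.commutes,
      partialD_jumpOp]
  | add p q hp hq =>
    simp only [map_add, add_mul, mul_add, hp, hq, dividedDiff_add hb]
    abel
  | mul p q hp hq =>
    rw [dividedDiff_mul hb]
    simp only [map_mul, map_add]
    rw [mul_assoc, hq, mul_add, ← mul_assoc, hp, add_mul, ← mul_assoc, diffOp_postComp, mul_add]
    simp only [mul_assoc, add_assoc]

theorem diffOp_jumpOp_apply (b : D.affineRoots) (p : SHat V) (f : AnalyticSpace V M) {x : VHat V}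
    (h : hatForm (b : VHat V) x = 0) : (diffOp V M p (D.jumpOp π b f)).1 x =
      π (D.incl (D.s b)) ((diffOp V M (dividedDiff (b : VHat V) p) f).1 x) := by
  rw [← Module.End.mul_apply, diffOp_jumpOp, LinearMap.add_apply]
  change (D.jumpOp π b _).1 x + _ = _
  rw [D.jumpOp_apply_of_form_eq_zero π b _ h, zero_add]
  rfl

variable [Finite ι] (k : D.affineRoots → ℂ)

theorem chamber_eq_iff (v w : D.extWeyl) : D.chamber v = D.chamber w ↔
    D.inversions ((v : VHat V ≃ₗ[ℝ] VHat V)⁻¹ * w) = ∅ := by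
  constructor
  · exact fun h => D.inversions_eq_empty_of_image_eq v.2 w.2 (congrArg Subtype.val h)
  · intro h
    have h1 := D.image_fundamental_eq (mul_mem (inv_mem v.2) w.2) h
    refine Subtype.ext ?_
    change (v : VHat V ≃ₗ[ℝ] VHat V) '' D.fundamental = (w : VHat V ≃ₗ[ℝ] VHat V) '' D.fundamental
    conv_lhs => rw [← h1, ← Set.image_comp]
    refine Set.image_congr fun x _ => ?_
    exact (v : VHat V ≃ₗ[ℝ] VHat V).apply_symm_apply _

/-- Ŵ already reaches the chamber of every w in Ŵ^Y, because w = v ω with ω preserving the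
fundamental chamber; so the choice in `element` succeeds. -/
theorem chamber_element (w : D.extWeyl) :
    D.chamber w = D.chamber (D.incl (D.element (D.chamber w))) := by
  obtain ⟨v, hv, h⟩ := D.exists_mul_inversions_eq_empty w.2
  exact Classical.epsilon_spec (p := fun v => D.chamber w = D.chamber (D.incl v))
    ⟨⟨v, hv⟩, ((D.chamber_eq_iff (D.incl ⟨v, hv⟩) w).2 h).symm⟩

theorem element_eq {w : D.extWeyl} {v : D.affineWeyl} (h : D.chamber w = D.chamber (D.incl v)) :
    D.element (D.chamber w) = v := by
  have h1 := (D.chamber_eq_iff _ _).1 (h.symm.trans (D.chamber_element w))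
  have h2 := D.eq_one_of_inversions_eq_empty
    (mul_mem (inv_mem v.2) (D.element (D.chamber w)).2) h1
  exact (Subtype.ext (inv_mul_eq_one.1 h2)).symm

theorem chamber_mul_congr (g : D.extWeyl) {v w : D.extWeyl} (h : D.chamber v = D.chamber w) :
    D.chamber (g * v) = D.chamber (g * w) := by
  rw [chamber_eq_iff] at h ⊢
  rw [Subgroup.coe_mul, Subgroup.coe_mul, mul_inv_rev, mul_assoc, inv_mul_cancel_left]
  exact h

theorem T_apply_chamber (f : AnalyticSpace V M) {w : D.extWeyl} {v : D.affineWeyl}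
    (h : D.chamber w = D.chamber (D.incl v)) :
    D.T π k f (D.chamber w) = D.act π (D.incl v) (D.Q π k v⁻¹ f) := by
  change D.act π (D.incl (D.element (D.chamber w))) (D.Q π k (D.element (D.chamber w))⁻¹ f) = _
  rw [D.element_eq h]

/-- The jump of `T f` across the wall of the root `b`. -/
theorem T_sub_T (hk : D.IsMultiplicityFunction k) (w : D.extWeyl) (b : D.affineRoots)
    (hb : (b : VHat V) ∈ (w : VHat V ≃ₗ[ℝ] VHat V) '' D.simpleAffineRoots)
    (f : AnalyticSpace V M) :
    D.T π k f (D.chamber w) - D.T π k f (D.chamber (D.incl (D.s b) * w)) =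
      k b • D.jumpOp π b (D.T π k f (D.chamber w)) := by
  obtain ⟨c, hc, hcb⟩ := hb
  have hv := D.chamber_element w
  set v := D.element (D.chamber w)
  -- Since v⁻¹ w preserves the fundamental chamber, it permutes the simple roots, and v⁻¹ b = (v⁻¹
  -- w) c.
  have ha : (v : VHat V ≃ₗ[ℝ] VHat V)⁻¹ (b : VHat V) ∈ D.simpleAffineRoots := by
    rw [← hcb]
    exact D.map_simple_of_inversions_eq_empty (mul_mem (inv_mem (D.incl v).2) w.2)
      ((D.chamber_eq_iff (D.incl v) w).1 hv.symm) hc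
  set a : D.affineRoots := ⟨_, D.simple_subset ha⟩
  have hva : (b : VHat V) = (v : VHat V ≃ₗ[ℝ] VHat V) a :=
    ((v : VHat V ≃ₗ[ℝ] VHat V).apply_symm_apply _).symm
  have hkb : k b = k a := hk (D.incl v) a b hva
  have hsv : D.s b * v = v * D.s a := by
    refine Subtype.ext ?_
    change hatReflection (b : VHat V) * (v : VHat V ≃ₗ[ℝ] VHat V) = _
    rw [hva, hatReflection_map (D.extWeyl_props (D.affineWeyl_le v.2)).1, inv_mul_cancel_right]
    rfl
  have hv' : D.chamber (D.incl (D.s b) * w) = D.chamber (D.incl (D.s b * v)) := by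
    rw [map_mul]
    exact D.chamber_mul_congr _ hv
  have hsinv : (D.s a)⁻¹ = D.s a := inv_eq_of_mul_eq_one_left (D.s_mul_self a)
  rw [D.T_apply_chamber π k f hv, D.T_apply_chamber π k f hv', hsv, mul_inv_rev, hsinv,
    map_mul (D.Q π k), Module.End.mul_apply, D.Q_s π k hk ha]
  generalize D.Q π k v⁻¹ f = g
  -- Conjugation by v carries s_a I(a) to s_b I(b), so the jump is expressed through the component v
  -- g itself.
  have h1 : D.jumpOp π b (D.act π (D.incl v) g) =
      D.act π (D.incl v) (D.act π (D.incl (D.s a)) (D.integralOp a g)) := by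
    have h := congrArg (fun z => D.act π (D.incl z) (D.integralOp a g)) hsv
    simp only [map_mul D.incl, act_mul, Module.End.mul_apply] at h
    rw [← h, D.act_integralOp π (D.incl v) hva]
    rfl
  have h2 : D.act π (D.incl (D.s a)) (D.act π (D.incl (D.s a)) g) = g := by
    rw [← Module.End.mul_apply, ← act_mul, ← map_mul, s_mul_self, map_one, act_one,
      Module.End.one_apply]
  rw [h1, hkb, map_mul, act_mul, Module.End.mul_apply, reflOp, LinearMap.sub_apply,
    LinearMap.smul_apply, map_sub, map_sub, map_smul, map_smul, h2, sub_sub_cancel]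

end Jump

end AffineRootDatum

/-! ### Jump relations for derivatives at the walls. -/

theorem mainTheorem8 {ι V M : Type*} [Finite ι]
    [NormedAddCommGroup V] [InnerProductSpace ℝ V] [FiniteDimensional ℝ V]
    [NormedAddCommGroup M] [NormedSpace ℂ M] [FiniteDimensional ℂ M]
    (D : AffineRootDatum ι V) (k : D.affineRoots → ℂ) (hk : D.IsMultiplicityFunction k)
    (π : Representation ℂ D.extWeyl M)
    (w : D.extWeyl) (b : D.affineRoots)
    (hb : (b : VHat V) ∈ (w : VHat V ≃ₗ[ℝ] VHat V) '' D.simpleAffineRoots)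
    (x : VHat V) (hx : x ∈ VHatPos V) (hxb : hatForm x (b : VHat V) = 0)
    (f : D.Chamber → AnalyticSpace V M) (hf : f ∈ LinearMap.range (D.T π k)) :
    (∀ p : SHat V,
      (diffOp V M p (f (D.chamber w))).1 x -
          (diffOp V M p (f (D.chamber (D.incl (D.s b) * w)))).1 x =
        k b • π (D.incl (D.s b))
          ((diffOp V M (dividedDiff (b : VHat V) p)
            (f (D.chamber w))).1 x)) ∧
    (f (D.chamber w)).1 x = (f (D.chamber (D.incl (D.s b) * w))).1 x ∧
    (∀ u : VHat V,
      (partialD u (f (D.chamber w))).1 x -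
          (partialD u (f (D.chamber (D.incl (D.s b) * w)))).1 x =
        -(k b * (hatForm u (b : VHat V) : ℂ)) • π (D.incl (D.s b)) ((f (D.chamber w)).1 x)) := by
  obtain ⟨f, rfl⟩ := hf
  have hb0 := (D.hatForm_self_pos b.2).ne'
  have key : ∀ p : SHat V,
      (diffOp V M p (D.T π k f (D.chamber w))).1 x -
          (diffOp V M p (D.T π k f (D.chamber (D.incl (D.s b) * w)))).1 x =
        k b • π (D.incl (D.s b))
          ((diffOp V M (dividedDiff (b : VHat V) p) (D.T π k f (D.chamber w))).1 x) := by
    intro p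
    have h := congrArg (diffOp V M p) (D.T_sub_T π k hk w b hb f)
    rw [map_sub, map_smul] at h
    rw [← D.diffOp_jumpOp_apply π b p _ (by rwa [hatForm_comm])]
    exact congrArg (fun g : AnalyticSpace V M => g.1 x) h
  refine ⟨key, ?_, fun u => ?_⟩
  -- Continuity across the wall is the case p = 1, where Δ_b(p) = 0.
  · have h := key (algebraMap ℂ _ 1)
    rw [dividedDiff_algebraMap hb0, map_one, map_one, map_zero] at h
    have h' : (D.T π k f (D.chamber w)).1 x -
        (D.T π k f (D.chamber (D.incl (D.s b) * w))).1 x = k b • π (D.incl (D.s b)) (0 : M) := h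
    rwa [map_zero, smul_zero, sub_eq_zero] at h'
  -- For p = u the divided difference is the scalar -(b, u).
  · have h := key (deg1 u)
    rw [dividedDiff_deg1 hb0, diffOp_deg1, AlgHom.commutes, Module.algebraMap_end_apply] at h
    refine h.trans ?_
    rw [hatForm_comm u]
    change k b • π (D.incl (D.s b)) (-(hatForm (b : VHat V) u : ℂ) • _) = _
    rw [map_smul, smul_smul, mul_neg]
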